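/- For $1\le q<\infty$ and $n\in\mathbb N$, $n\ge 1$, let $B_q^n=\{x\in\mathbb R^n:\sum_{j=1}^n|x_j|^q\le 1\}$ denote the closed unit ball of $l_q^n$. For a unit vector $a$ of the Euclidean space $\mathbb R^n$ let $$P_{n,q}(a):=\frac{\mathrm{vol}_{n-1}\big(P_{a^\perp}(B_q^n)\big)}{\mathrm{vol}_{n-1}(B_q^{n-1})},$$ where $P_{a^\perp}$ is the orthogonal projection of $\mathbb R^n$ onto the hyperplane $a^\perp$. Let $a^{(n)}=\frac1{\sqrt n}(1,\dots,1)\in\mathbb R^n$ and, for $n\ge 2$, $a^{(2)}=\frac1{\sqrt2}(1,1,0,\dots,0)\in\mathbb R^n$. **Theorem.** Let $\frac43<q<2$. Then $$\lim_{n\to\infty}\frac{P_{n,q}(a^{(n)})}{P_{n,q}(a^{(2)})}=\sqrt{\frac1\pi}\,\sqrt{2^{2/q}\,\Gamma\!\left(\tfrac1q\right)\Gamma\!\left(2-\tfrac1q\right)}<1 .$$ Moreover, $P_{n,q}(a^{(n)})<P_{n,q}(a^{(2)})$ holds for every $n\in\mathbb N$ with $$n>\frac{32/15}{q-\frac43}+\frac{24/5}{2-q}.$$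 -/

import Mathlib

open Filter Topology MeasureTheory

noncomputable section

/-- The closed unit ball of `l_q^n` (for `1 ≤ q < ∞`), as a subset of Euclidean space `ℝⁿ`. -/
def lqBall (n : ℕ) (q : ℝ) : Set (EuclideanSpace ℝ (Fin n)) :=
  {x | ∑ i, |x i| ^ q ≤ 1}

/-- The normalized projection function `P_{n,q}(a)`: the `(n - 1)`-dimensional volume of the
orthogonal projection of the unit ball of `l_q^n` onto the hyperplane orthogonal to the unit
vector `a`, divided by the volume of the unit ball of `l_q^{n-1}`. The first `volume` is the
Lebesgue measure of the hyperplane as a Euclidean space of its own (for which the parallelepiped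
spanned by an orthonormal basis of the hyperplane has measure `1`). -/
def projVol (n : ℕ) (q : ℝ) (a : EuclideanSpace ℝ (Fin n)) : ℝ :=
  (volume ((Submodule.span ℝ {a})ᗮ.orthogonalProjectionOnto '' lqBall n q)).toReal /
    (volume (lqBall (n - 1) q)).toReal

/-- The vector `a^{(k)} = (1, …, 1, 0, …, 0) / √k` of `ℝⁿ`, with `k` ones (`1 ≤ k ≤ n`). -/
def diagVec (n k : ℕ) : EuclideanSpace ℝ (Fin n) :=
  WithLp.toLp 2 fun i => if (i : ℕ) < k then 1 / √(k : ℝ) else 0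

end

/-! Let N(x) = ∑ |x_i|^q and integrate |∂_a N| e^{-N} over ℝⁿ. On each line parallel to a, N is
convex with infinite limits, so the line contributes 2 e^{-m}, where m is the minimum of N on that
line. By homogeneity the set of lines with m ≤ r is the projected ball dilated by r^(1/q), so the
integral equals 2 Γ((n-1)/q + 1) times the volume of the projection
(`lintegral_eq_volume_proj_lqBall`). On the other hand ∂_a N = q ∑ a_i ξ(x_i) with ξ = `xi q`. Hence
projection volumes are first absolute moments of weighted sums of independent copies of ξ(X), where
X has density proportional to e^{-|x|^q}.

Since (π/2) E|Z| = ∫_0^∞ (1 - E cos(tZ)) / t² dt, these moments are integrals of powers of one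
characteristic function (`projVol_diagVec`). For two summands the moment is explicit
(`absMoment_two`). For n summands the central limit theorem and dominated convergence give the limit
after division by √n. By the reflection formula the limiting ratio is exp(-`logGap` (1/q) / 2), and
a concavity argument bounds `logGap` below by a multiple of (3/4 - s)(s - 1/2), s = 1/q, so the
limit is less than 1.

For finite n it suffices that the n-fold moment exceeds its asymptotic value by a factor of at most
1 + (6/25)/n (`absMoment_le`), because 1 + x ≤ e^x and the hypothesis on n gives (6/25)/n < `logGap`
(1/q) / 2. The normalised characteristic function is bounded below by 1 - u²/2 near 0, by cosines at
moderate u, and by -2.7/u at large u. The first bound produces Wallis integrals, which carry the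
main term; the others give exponentially small terms and one of order 1/n. -/

noncomputable section

open Set Real

/-! ### The odd power function and integrals of |g'| e^{-g} -/

/-- The function `sign(x) |x|^(q-1)`, so that `q * xi q` is the derivative of `|x|^q`. -/
def xi (q x : ℝ) : ℝ := |x| ^ (q - 2) * x

lemma xi_of_nonneg {q x : ℝ} (hq : 1 < q) (hx : 0 ≤ x) : xi q x = x ^ (q - 1) := by
  unfold xi
  rcases hx.eq_or_lt with rfl | hx
  · simp [Real.zero_rpow (by linarith : q - 1 ≠ 0)]
  · rw [abs_of_pos hx, ← Real.rpow_add_one hx.ne']; congr 1; ring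

lemma xi_neg (q x : ℝ) : xi q (-x) = -xi q x := by simp [xi]

lemma abs_xi {q : ℝ} (hq : 1 < q) (x : ℝ) : |xi q x| = |x| ^ (q - 1) := by
  rcases le_total 0 x with hx | hx
  · rw [xi_of_nonneg hq hx, abs_of_nonneg hx, abs_of_nonneg (Real.rpow_nonneg hx _)]
  · have hx' : 0 ≤ -x := by linarith
    rw [← abs_neg, ← xi_neg, xi_of_nonneg hq hx', abs_of_nonneg (Real.rpow_nonneg hx' _),
      abs_of_nonpos hx]

lemma monotone_xi {q : ℝ} (hq : 1 < q) : Monotone (xi q) := by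
  have hq' : 0 ≤ q - 1 := by linarith
  intro x y hxy
  rcases le_total 0 x with hx | hx
  · rw [xi_of_nonneg hq hx, xi_of_nonneg hq (hx.trans hxy)]
    exact Real.rpow_le_rpow hx hxy hq'
  · have h1 : xi q x = -(-x) ^ (q - 1) := by
      rw [← xi_of_nonneg hq (by linarith), xi_neg, neg_neg]
    rcases le_total 0 y with hy | hy
    · rw [h1, xi_of_nonneg hq hy]
      have := Real.rpow_nonneg (neg_nonneg.2 hx) (q - 1)
      have := Real.rpow_nonneg hy (q - 1)
      linarith
    · have h2 : xi q y = -(-y) ^ (q - 1) := by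
        rw [← xi_of_nonneg hq (by linarith), xi_neg, neg_neg]
      rw [h1, h2, neg_le_neg_iff]
      exact Real.rpow_le_rpow (by linarith) (by linarith) hq'

@[fun_prop]
lemma measurable_xi (q : ℝ) : Measurable (xi q) := by unfold xi; fun_prop

lemma hasDerivAt_abs_rpow_xi {q : ℝ} (hq : 1 < q) (x : ℝ) :
    HasDerivAt (fun x => |x| ^ q) (q * xi q x) x := by
  have := hasDerivAt_abs_rpow x hq
  rwa [mul_assoc] at this

lemma lintegral_Ioi_abs_deriv_mul_exp_neg {g g' : ℝ → ℝ} {s₀ : ℝ}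
    (hg : ∀ s, HasDerivAt g (g' s) s) (hge : ∀ s > s₀, 0 ≤ g' s) (htop : Tendsto g atTop atTop) :
    ∫⁻ s in Ioi s₀, ENNReal.ofReal (|g' s| * exp (-g s)) = ENNReal.ofReal (exp (-g s₀)) := by
  have hd : ∀ x ∈ Ici s₀, HasDerivAt (fun s => -exp (-g s)) (g' x * exp (-g x)) x := by
    intro x _
    have := ((hg x).neg.exp).neg
    convert! this using 1
    simp [mul_comm]
  have hpos : ∀ x ∈ Ioi s₀, 0 ≤ g' x * exp (-g x) := fun x hx =>
    mul_nonneg (hge x hx) (exp_pos _).le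
  have hlim : Tendsto (fun s => -exp (-g s)) atTop (𝓝 0) := by
    have := (Real.tendsto_exp_neg_atTop_nhds_zero.comp htop).neg
    simpa using this
  have hint := integrableOn_Ioi_deriv_of_nonneg' hd hpos hlim
  have hval := integral_Ioi_of_hasDerivAt_of_nonneg' hd hpos hlim
  have : ∫⁻ s in Ioi s₀, ENNReal.ofReal (|g' s| * exp (-g s)) =
      ∫⁻ s in Ioi s₀, ENNReal.ofReal (g' s * exp (-g s)) := by
    refine setLIntegral_congr_fun measurableSet_Ioi fun s hs => ?_
    simp only [abs_of_nonneg (hge s hs)]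
  rw [this, ← ofReal_integral_eq_lintegral_ofReal hint, hval]
  · simp
  · filter_upwards [ae_restrict_mem measurableSet_Ioi] with x hx using hpos x hx

/-- For `g` decreasing to its minimum at `s₀` and increasing afterwards, with infinite limits at
both ends, the integral of `|g'| e^{-g}` is `2 e^{-g(s₀)}`. -/
lemma lintegral_abs_deriv_mul_exp_neg {g g' : ℝ → ℝ} {s₀ : ℝ}
    (hg : ∀ s, HasDerivAt g (g' s) s) (hle : ∀ s < s₀, g' s ≤ 0) (hge : ∀ s > s₀, 0 ≤ g' s)
    (htop : Tendsto g atTop atTop) (hbot : Tendsto g atBot atTop) :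
    ∫⁻ s, ENNReal.ofReal (|g' s| * exp (-g s)) = ENNReal.ofReal (2 * exp (-g s₀)) := by
  have h1 := lintegral_Ioi_abs_deriv_mul_exp_neg hg hge htop
  have h2 := lintegral_Ioi_abs_deriv_mul_exp_neg (g := fun s => g (-s)) (g' := fun s => -g' (-s))
    (s₀ := -s₀) (fun s => by
      have := (hg (-s)).comp s (hasDerivAt_neg s)
      simpa [Function.comp_def] using this)
    (fun s hs => by have := hle (-s) (by simp at hs; linarith); linarith)
    (hbot.comp tendsto_neg_atTop_atBot)
  have h3 : ∫⁻ s in Ioi (-s₀), ENNReal.ofReal (|(-g' (-s))| * exp (-g (-s))) =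
      ∫⁻ s in Iio s₀, ENNReal.ofReal (|g' s| * exp (-g s)) := by
    have := (Measure.measurePreserving_neg (volume : Measure ℝ)).setLIntegral_comp_preimage_emb
      (MeasurableEquiv.neg ℝ).measurableEmbedding
      (fun s => ENNReal.ofReal (|g' s| * exp (-g s))) (Iio s₀)
    simpa using this
  rw [h3, ← setLIntegral_congr Iio_ae_eq_Iic.symm] at h2
  rw [← lintegral_add_compl _ (measurableSet_Iic (a := s₀)), compl_Iic, h1, h2]
  simp only [neg_neg]
  rw [← ENNReal.ofReal_add (exp_pos _).le (exp_pos _).le]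
  congr 1; ring

/-! ### Projection volume as an integral over the whole space -/

section Fubini

variable {E : Type*} [NormedAddCommGroup E] [InnerProductSpace ℝ E] [FiniteDimensional ℝ E]
  [MeasurableSpace E] [BorelSpace E]

/-- Fubini's theorem for the splitting of a Euclidean space into a line and its orthogonal
complement. -/
lemma lintegral_eq_lintegral_orthogonal_span {a : E} (ha : ‖a‖ = 1) {F : E → ENNReal}
    (hF : Measurable F) :
    ∫⁻ x, F x = ∫⁻ y : (Submodule.span ℝ {a})ᗮ, ∫⁻ s : ℝ, F (y + s • a) := by
  set K := Submodule.span ℝ {a}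
  have h1 := K.orthogonalDecomposition.symm.measurePreserving.lintegral_comp hF
  have h2 := (WithLp.volume_preserving_toLp K Kᗮ).lintegral_comp
    (f := fun z => F (K.orthogonalDecomposition.symm z))
    (hF.comp K.orthogonalDecomposition.symm.continuous.measurable)
  rw [← h1, ← h2]
  have hsymm : ∀ z : K × Kᗮ, K.orthogonalDecomposition.symm (WithLp.toLp 2 z) = (z.1 : E) + z.2 := by
    intro z; simp
  simp only [hsymm]
  have hm : Measurable fun z : K × Kᗮ => F ((z.1 : E) + z.2) := hF.comp (by fun_prop)
  rw [Measure.volume_eq_prod, lintegral_prod_symm' _ hm]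
  refine lintegral_congr fun y => ?_
  have h3 := (LinearIsometryEquiv.toSpanUnitSingleton (𝕜 := ℝ) a ha).measurePreserving.lintegral_comp
    (f := fun z : K => F ((z : E) + y)) (hF.comp (by fun_prop))
  rw [← h3]
  refine lintegral_congr fun s => ?_
  simp [add_comm]

end Fubini

/-- `∑ |x_i|^q`. -/
def powSum {n : ℕ} (q : ℝ) (x : EuclideanSpace ℝ (Fin n)) : ℝ := ∑ i, |x i| ^ q

lemma powSum_nonneg {n : ℕ} (q : ℝ) (x : EuclideanSpace ℝ (Fin n)) : 0 ≤ powSum q x :=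
  Finset.sum_nonneg fun i _ => by positivity

lemma continuous_powSum {n : ℕ} {q : ℝ} (hq : 0 ≤ q) :
    Continuous (powSum (n := n) q) := by
  unfold powSum
  refine continuous_finsetSum _ fun i _ => ?_
  exact Continuous.rpow_const (by fun_prop) fun x => Or.inr hq

lemma isCompact_lqBall (n : ℕ) {q : ℝ} (hq : 0 < q) : IsCompact (lqBall n q) := by
  have hcl : IsClosed (lqBall n q) := isClosed_le (continuous_powSum hq.le) continuous_const
  have hcpt : IsCompact (WithLp.ofLp ⁻¹' Set.pi univ (fun _ : Fin n => Icc (-1 : ℝ) 1) :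
      Set (EuclideanSpace ℝ (Fin n))) :=
    (PiLp.homeomorph 2 (fun _ : Fin n => ℝ)).isCompact_preimage.2
      (isCompact_univ_pi fun _ => isCompact_Icc)
  refine hcpt.of_isClosed_subset hcl fun x hx => ?_
  simp only [mem_preimage, mem_univ_pi]
  intro i
  refine mem_Icc.2 (abs_le.1 ?_)
  by_contra! h
  have h1 : 1 < |x i| ^ q := Real.one_lt_rpow h hq
  have h2 : |x i| ^ q ≤ ∑ i, |x i| ^ q :=
    Finset.single_le_sum (f := fun i => |x i| ^ q) (fun j _ => by positivity) (Finset.mem_univ i)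
  have h3 : ∑ i, |x i| ^ q ≤ 1 := hx
  linarith

lemma powSum_smul {n : ℕ} {q c : ℝ} (hc : 0 ≤ c) (x : EuclideanSpace ℝ (Fin n)) :
    powSum q (c • x) = c ^ q * powSum q x := by
  simp only [powSum, PiLp.smul_apply, smul_eq_mul, abs_mul, abs_of_nonneg hc, Finset.mul_sum]
  refine Finset.sum_congr rfl fun i _ => ?_
  rw [Real.mul_rpow hc (abs_nonneg _)]

section Line

variable {n : ℕ} {q : ℝ} {a : EuclideanSpace ℝ (Fin n)}

lemma hasDerivAt_powSum_line (hq : 1 < q) (y : EuclideanSpace ℝ (Fin n)) (s : ℝ) :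
    HasDerivAt (fun s : ℝ => powSum q (y + s • a))
      (∑ i, a i * (q * xi q ((y + s • a) i))) s := by
  unfold powSum
  refine HasDerivAt.fun_sum fun i _ => ?_
  have h1 : HasDerivAt (fun s : ℝ => (y + s • a) i) (a i) s := by
    have := ((hasDerivAt_id s).mul_const (a i)).const_add (y i)
    simpa using this
  have := (hasDerivAt_abs_rpow_xi hq ((y + s • a) i)).comp s h1
  simpa [Function.comp_def, mul_comm] using this

lemma tendsto_powSum_line (hq : 1 < q) {i : Fin n} (hi : a i ≠ 0)
    (y : EuclideanSpace ℝ (Fin n)) :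
    Tendsto (fun s : ℝ => powSum q (y + s • a)) (cocompact ℝ) atTop := by
  have h1 : Tendsto (fun s : ℝ => |y i + s * a i| ^ q) (cocompact ℝ) atTop := by
    refine (tendsto_rpow_atTop (by linarith : 0 < q)).comp ?_
    have h2 : Tendsto (fun s : ℝ => y i + s * a i) (cocompact ℝ) (cocompact ℝ) :=
      ((Homeomorph.mulRight₀ (a i) hi).trans
        (Homeomorph.addLeft (y i))).isClosedEmbedding.tendsto_cocompact
    exact tendsto_norm_cocompact_atTop.comp h2
  refine tendsto_atTop_mono (fun s => ?_) h1
  have := Finset.single_le_sum (f := fun j => |(y + s • a) j| ^ q)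
    (fun j _ => by positivity) (Finset.mem_univ i)
  simpa [powSum] using this

/-- Along the line the sum is convex, and a nonzero coordinate of `a` forces it to infinity at both
ends. Its derivative is therefore monotone and changes sign at a minimiser, so the identity for
unimodal functions applies. -/
lemma exists_min_powSum_line (hq : 1 < q) (ha : a ≠ 0) (y : EuclideanSpace ℝ (Fin n)) :
    ∃ s₀ : ℝ, (∀ s : ℝ, powSum q (y + s₀ • a) ≤ powSum q (y + s • a)) ∧
      ∫⁻ s : ℝ, ENNReal.ofReal (|∑ i, a i * (q * xi q ((y + s • a) i))| * exp (-powSum q (y + s • a)))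
        = ENNReal.ofReal (2 * exp (-powSum q (y + s₀ • a))) := by
  obtain ⟨i, hi⟩ : ∃ i, a i ≠ 0 := by
    by_contra! h
    exact ha (by ext i; simpa using h i)
  have htend := tendsto_powSum_line hq hi y
  have hd := fun s => hasDerivAt_powSum_line (a := a) hq y s
  have hcont : Continuous fun s : ℝ => powSum q (y + s • a) :=
    continuous_iff_continuousAt.2 fun s => (hd s).continuousAt
  obtain ⟨s₀, hs₀⟩ := hcont.exists_forall_le htend
  have hzero : ∑ i, a i * (q * xi q ((y + s₀ • a) i)) = 0 :=
    IsLocalMin.hasDerivAt_eq_zero (Filter.Eventually.of_forall hs₀) (hd s₀)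
  have hmono : Monotone fun s : ℝ => ∑ i, a i * (q * xi q ((y + s • a) i)) := by
    intro s t hst
    refine Finset.sum_le_sum fun j _ => ?_
    have hq0 : 0 ≤ q := by linarith
    simp only [PiLp.add_apply, PiLp.smul_apply, smul_eq_mul]
    rcases le_total 0 (a j) with h | h
    · have := monotone_xi hq (by nlinarith : y j + s * a j ≤ y j + t * a j)
      gcongr
    · have := monotone_xi hq (by nlinarith : y j + t * a j ≤ y j + s * a j)
      exact mul_le_mul_of_nonpos_left (by gcongr) h
  refine ⟨s₀, hs₀, ?_⟩
  rw [cocompact_eq_atBot_atTop] at htend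
  exact lintegral_abs_deriv_mul_exp_neg hd (fun s hs => hzero ▸ hmono hs.le)
    (fun s hs => hzero ▸ hmono hs.le) (htend.mono_left le_sup_right) (htend.mono_left le_sup_left)

end Line

/-- Homogeneity of degree q turns the level r into the level 1, and the fibre of the projection over
y is the line y + ℝ a. -/
lemma mem_proj_image_lqBall_iff {n : ℕ} {q r : ℝ} (hq : 0 < q) (hr : 0 < r)
    {a : EuclideanSpace ℝ (Fin n)} (y : (Submodule.span ℝ {a})ᗮ) :
    r ^ (-1 / q) • y ∈ (Submodule.span ℝ {a})ᗮ.orthogonalProjectionOnto '' lqBall n q ↔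
      ∃ s : ℝ, powSum q ((y : EuclideanSpace ℝ (Fin n)) + s • a) ≤ r := by
  set c := r ^ (-1 / q)
  have hc : 0 < c := Real.rpow_pos_of_pos hr _
  have hcq : c ^ q = r⁻¹ := by
    rw [← Real.rpow_mul hr.le, div_mul_cancel₀ _ hq.ne', Real.rpow_neg_one]
  have key : ∀ s : ℝ, c • ((y : EuclideanSpace ℝ (Fin n)) + s • a) ∈ lqBall n q ↔
      powSum q ((y : EuclideanSpace ℝ (Fin n)) + s • a) ≤ r := by
    intro s
    change powSum q (c • ((y : EuclideanSpace ℝ (Fin n)) + s • a)) ≤ 1 ↔ _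
    rw [powSum_smul hc.le, hcq, inv_mul_le_iff₀ hr, mul_one]
  have ha : a ∈ Submodule.span ℝ {a} := Submodule.mem_span_singleton_self a
  have hpa : (Submodule.span ℝ {a})ᗮ.orthogonalProjectionOnto a = 0 :=
    Submodule.orthogonalProjectionOnto_orthogonal_apply_eq_zero ha
  constructor
  · rintro ⟨x, hx, hxy⟩
    have hdec := Submodule.starProjection_add_starProjection_orthogonal (K := Submodule.span ℝ {a}) x
    obtain ⟨s, hs⟩ := Submodule.mem_span_singleton.1
      ((Submodule.span ℝ {a}).starProjection_apply_mem x)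
    refine ⟨c⁻¹ * s, (key _).1 ?_⟩
    have h2 : (Submodule.span ℝ {a})ᗮ.starProjection x = c • (y : EuclideanSpace ℝ (Fin n)) := by
      rw [Submodule.starProjection_apply, hxy]; rfl
    have : c • ((y : EuclideanSpace ℝ (Fin n)) + (c⁻¹ * s) • a) = x := by
      rw [← hdec, ← hs, h2, smul_add, smul_smul, mul_inv_cancel_left₀ hc.ne', add_comm]
    rwa [this]
  · rintro ⟨s, hs⟩
    refine ⟨_, (key s).2 hs, ?_⟩
    rw [map_smul, map_add, map_smul, hpa, smul_zero, add_zero]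
    simp

lemma lintegral_two_mul_exp_neg_Ioi {m : ℝ} (hm : 0 ≤ m) :
    ∫⁻ r in Ioi 0, ENNReal.ofReal (2 * exp (-r)) * (Ici m).indicator 1 r =
      ENNReal.ofReal (2 * exp (-m)) := by
  have h : ∀ r, ENNReal.ofReal (2 * exp (-r)) * (Ici m).indicator 1 r =
      (Ici m).indicator (fun r => ENNReal.ofReal (2 * exp (-r))) r := by
    intro r; by_cases hr : r ∈ Ici m <;> simp [hr]
  simp only [h]
  rw [lintegral_indicator measurableSet_Ici, Measure.restrict_restrict measurableSet_Ici]
  have : (Ici m ∩ Ioi 0 : Set ℝ) =ᵐ[volume] Ioi m := by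
    rcases hm.eq_or_lt with rfl | hm
    · rw [inter_eq_right.2 Ioi_subset_Ici_self]
      exact ae_eq_refl _
    · have : Ici m ∩ Ioi 0 = Ici m := inter_eq_left.2 fun x hx => hm.trans_le hx
      rw [this]
      exact Ioi_ae_eq_Ici.symm
  rw [Measure.restrict_congr_set this, ← ofReal_integral_eq_lintegral_ofReal, integral_const_mul,
    integral_exp_neg_Ioi]
  · exact (integrableOn_exp_neg_Ioi m).const_mul 2
  · exact Eventually.of_forall fun r => by positivity

lemma lintegral_two_mul_exp_neg_mul_rpow {b : ℝ} (hb : 0 ≤ b) :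
    ∫⁻ r in Ioi 0, ENNReal.ofReal (2 * exp (-r)) * ENNReal.ofReal (r ^ b) =
      ENNReal.ofReal (2 * Gamma (b + 1)) := by
  rw [Real.Gamma_eq_integral (by linarith), ← integral_const_mul,
    ofReal_integral_eq_lintegral_ofReal]
  · refine setLIntegral_congr_fun measurableSet_Ioi fun r hr => ?_
    rw [← ENNReal.ofReal_mul (by positivity)]
    congr 1; rw [add_sub_cancel_right]; ring
  · exact (Real.GammaIntegral_convergent (by linarith)).const_mul 2
  · filter_upwards [ae_restrict_mem measurableSet_Ioi] with r hr
    have : (0 : ℝ) < r := hr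
    positivity

/-- The volume of the projection of the ball of `l_q^n` along a unit vector `a` as an integral
of the directional derivative of `∑ |x_i|^q` over the whole space. -/
lemma lintegral_eq_volume_proj_lqBall {n : ℕ} {q : ℝ} (hq : 1 < q)
    {a : EuclideanSpace ℝ (Fin n)} (ha : ‖a‖ = 1) (hn : 1 ≤ n) :
    ∫⁻ x : EuclideanSpace ℝ (Fin n),
        ENNReal.ofReal (|∑ i, a i * (q * xi q (x i))| * exp (-powSum q x)) =
      ENNReal.ofReal (2 * Gamma ((n - 1 : ℕ) / q + 1)) *
        volume ((Submodule.span ℝ {a})ᗮ.orthogonalProjectionOnto '' lqBall n q) := by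
  have hq0 : 0 < q := by linarith
  have ha0 : a ≠ 0 := by rintro rfl; simp at ha
  set P := (Submodule.span ℝ {a})ᗮ.orthogonalProjectionOnto '' lqBall n q with hP
  have hPm : MeasurableSet P :=
    ((isCompact_lqBall n hq0).image (ContinuousLinearMap.continuous _)).measurableSet
  have hmeas : Measurable fun x : EuclideanSpace ℝ (Fin n) =>
      ENNReal.ofReal (|∑ i, a i * (q * xi q (x i))| * exp (-powSum q x)) := by
    have := (continuous_powSum (n := n) hq0.le).measurable
    fun_prop
  rw [lintegral_eq_lintegral_orthogonal_span ha hmeas]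
  -- Layer cake: 2 e^{-m} is the integral of 2 e^{-r} over r ≥ m, and the minimum m over the line
  -- through y is at most r exactly when r^(-1/q) y lies in P.
  have hinner : ∀ y : (Submodule.span ℝ {a})ᗮ,
      ∫⁻ s : ℝ, ENNReal.ofReal (|∑ i, a i * (q * xi q ((y + s • a : EuclideanSpace ℝ (Fin n)) i))|
        * exp (-powSum q (y + s • a : EuclideanSpace ℝ (Fin n)))) =
      ∫⁻ r in Ioi (0 : ℝ), ENNReal.ofReal (2 * exp (-r)) *
        P.indicator 1 (r ^ (-1 / q) • y) := by
    intro y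
    obtain ⟨s₀, hmin, hval⟩ := exists_min_powSum_line hq ha0 (y : EuclideanSpace ℝ (Fin n))
    rw [hval, ← lintegral_two_mul_exp_neg_Ioi
      (powSum_nonneg q _)]
    refine setLIntegral_congr_fun measurableSet_Ioi fun r hr => ?_
    congr 1
    have hiff := mem_proj_image_lqBall_iff hq0 hr y
    by_cases h : powSum q ((y : EuclideanSpace ℝ (Fin n)) + s₀ • a) ≤ r
    · rw [indicator_of_mem (mem_Ici.2 h), indicator_of_mem (hiff.2 ⟨s₀, h⟩)]; rfl
    · rw [indicator_of_notMem (by simpa using h), indicator_of_notMem]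
      rintro h'
      obtain ⟨s, hs⟩ := hiff.1 h'
      exact h ((hmin s).trans hs)
  simp only [hinner]
  rw [lintegral_lintegral_swap]
  -- A dilation by r^(1/q) in dimension n - 1 multiplies volume by r^((n-1)/q); integrating this
  -- against 2 e^{-r} gives the Gamma factor.
  · have hvol : ∀ r ∈ Ioi (0 : ℝ), ∫⁻ y : (Submodule.span ℝ {a})ᗮ, ENNReal.ofReal (2 * exp (-r)) *
        P.indicator 1 (r ^ (-1 / q) • y) =
        ENNReal.ofReal (2 * exp (-r)) * ENNReal.ofReal (r ^ ((n - 1 : ℕ) / q)) * volume P := by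
      intro r hr
      have hr' : (0 : ℝ) < r := hr
      have hc : 0 < r ^ (-1 / q) := Real.rpow_pos_of_pos hr _
      rw [lintegral_const_mul' _ _ ENNReal.ofReal_ne_top, mul_assoc]
      congr 1
      have : (fun y : (Submodule.span ℝ {a})ᗮ => P.indicator (1 : (Submodule.span ℝ {a})ᗮ → ENNReal) (r ^ (-1 / q) • y)) =
          ((r ^ (-1 / q) • ·) ⁻¹' P).indicator 1 := by
        ext y; rfl
      rw [this, lintegral_indicator_one (hPm.preimage (by fun_prop)),
        Measure.addHaar_preimage_smul _ hc.ne']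
      congr 2
      have hfin : Module.finrank ℝ (Submodule.span ℝ {a})ᗮ = n - 1 := by
        have : Fact (Module.finrank ℝ (EuclideanSpace ℝ (Fin n)) = (n - 1) + 1) :=
          ⟨by simp; omega⟩
        exact Submodule.finrank_orthogonal_span_singleton ha0
      rw [hfin, abs_of_pos (by positivity), ← Real.rpow_natCast, ← Real.rpow_mul hr'.le,
        ← Real.rpow_neg hr'.le]
      congr 1; ring
    rw [setLIntegral_congr_fun measurableSet_Ioi hvol, lintegral_mul_const,
      lintegral_two_mul_exp_neg_mul_rpow (by positivity)]
    fun_prop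
  · have h1 : Measurable fun z : (Submodule.span ℝ {a})ᗮ × ℝ => z.2 ^ (-1 / q) • z.1 :=
      (Measurable.pow_const measurable_snd _).smul measurable_fst
    have h2 : Measurable (P.indicator (1 : (Submodule.span ℝ {a})ᗮ → ENNReal)) :=
      measurable_one.indicator hPm
    exact ((by fun_prop : Measurable fun z : (Submodule.span ℝ {a})ᗮ × ℝ =>
      ENNReal.ofReal (2 * exp (-z.2))).mul (h2.comp h1)).aemeasurable

/-! ### First absolute moments through characteristic functions -/

lemma one_sub_exp_neg_sq_div_nonneg (t : ℝ) : 0 ≤ (1 - exp (-t ^ 2 / 2)) / t ^ 2 := by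
  refine div_nonneg (sub_nonneg.2 (exp_le_one_iff.2 ?_)) (sq_nonneg t)
  nlinarith [sq_nonneg t]

lemma one_sub_exp_neg_sq_div_aux :
    IntegrableOn (fun t : ℝ => (1 - exp (-t ^ 2 / 2)) / t ^ 2) (Ioi 0) ∧
      ∫ t in Ioi (0 : ℝ), (1 - exp (-t ^ 2 / 2)) / t ^ 2 = √(π / 2) := by
  set G : ℝ → ℝ := fun t => exp (-(1 / 2) * t ^ 2) with hG
  have hGint : IntegrableOn G (Ioi 0) := (integrable_exp_neg_mul_sq (by norm_num)).integrableOn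
  have hGval : ∫ t in Ioi 0, G t = √(π / 2) := by
    rw [hG, integral_gaussian_Ioi]
    have : π / (1 / 2) = π / 2 * 2 ^ 2 := by ring
    rw [this, Real.sqrt_mul (by positivity), Real.sqrt_sq (by norm_num)]
    ring
  have hGc : Continuous G := by fun_prop
  -- Antiderivative found by integrating 1/t² by parts. At t = 0 the convention x / 0 = 0 agrees
  -- with the limit of (1 - G t) / t, because 0 ≤ 1 - G t ≤ t²/2.
  set F : ℝ → ℝ := fun t => (∫ s in (0 : ℝ)..t, G s) - (1 - G t) / t with hF
  have hcont : ContinuousWithinAt F (Ici 0) 0 := by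
    have h1 : ContinuousAt (fun t : ℝ => ∫ s in (0 : ℝ)..t, G s) 0 :=
      (intervalIntegral.integral_hasDerivAt_right (hGc.intervalIntegrable _ _)
        hGc.aestronglyMeasurable.stronglyMeasurableAtFilter hGc.continuousAt).continuousAt
    have h2 : ContinuousAt (fun t : ℝ => (1 - G t) / t) 0 := by
      have hlim : Tendsto (fun t : ℝ => |t|) (𝓝 0) (𝓝 0) := by
        simpa using (continuous_abs (G := ℝ)).tendsto 0
      have : Tendsto (fun t : ℝ => (1 - G t) / t) (𝓝 0) (𝓝 0) := by
        refine squeeze_zero_norm (fun t => ?_) hlim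
        rcases eq_or_ne t 0 with rfl | ht
        · simp
        rw [norm_div, Real.norm_eq_abs, Real.norm_eq_abs, div_le_iff₀ (abs_pos.2 ht), abs_mul_abs_self]
        have h1 := Real.add_one_le_exp (-(1 / 2) * t ^ 2)
        have h2 : G t ≤ 1 := exp_le_one_iff.2 (by nlinarith [sq_nonneg t])
        rw [abs_of_nonneg (by linarith)]
        simp only [hG]
        nlinarith [sq_nonneg t]
      rw [ContinuousAt]
      simpa using this
    exact (h1.sub h2).continuousWithinAt
  have hderiv : ∀ t ∈ Ioi (0 : ℝ), HasDerivAt F ((1 - exp (-t ^ 2 / 2)) / t ^ 2) t := by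
    intro t ht
    have ht0 : t ≠ 0 := ne_of_gt ht
    have h1 : HasDerivAt (fun t : ℝ => ∫ s in (0 : ℝ)..t, G s) (G t) t :=
      (intervalIntegral.integral_hasDerivAt_right (hGc.intervalIntegrable _ _)
        hGc.aestronglyMeasurable.stronglyMeasurableAtFilter hGc.continuousAt)
    have h2 : HasDerivAt G (G t * (-(1 / 2) * (2 * t))) t := by
      have := ((hasDerivAt_pow 2 t).const_mul (-(1 / 2 : ℝ))).exp
      simpa [hG] using this
    have h3 := h1.sub (((hasDerivAt_const t (1 : ℝ)).sub h2).div (hasDerivAt_id t) ht0)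
    convert! h3 using 1
    have : exp (-t ^ 2 / 2) = G t := by simp only [hG]; congr 1; ring
    rw [this]
    simp only [Pi.sub_apply, id]
    field_simp
    ring
  have hlim : Tendsto F atTop (𝓝 √(π / 2)) := by
    have h1 := intervalIntegral_tendsto_integral_Ioi 0 hGint tendsto_id
    rw [hGval] at h1
    have h2 : Tendsto (fun t : ℝ => (1 - G t) / t) atTop (𝓝 0) := by
      refine squeeze_zero' (g := fun t : ℝ => t⁻¹) ?_ ?_ tendsto_inv_atTop_zero
      · filter_upwards [eventually_gt_atTop 0] with t ht
        exact div_nonneg (sub_nonneg.2 (exp_le_one_iff.2 (by nlinarith [sq_nonneg t]))) ht.le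
      · filter_upwards [eventually_gt_atTop 0] with t ht
        rw [div_eq_mul_inv]
        have := exp_pos (-(1 / 2) * t ^ 2)
        have h3 : 0 < t⁻¹ := inv_pos.2 ht
        simp only [hG]
        nlinarith
    simpa using h1.sub h2
  have hpos : ∀ t ∈ Ioi (0 : ℝ), 0 ≤ (1 - exp (-t ^ 2 / 2)) / t ^ 2 := fun t _ =>
    one_sub_exp_neg_sq_div_nonneg t
  refine ⟨integrableOn_Ioi_deriv_of_nonneg hcont hderiv hpos hlim, ?_⟩
  rw [integral_Ioi_of_hasDerivAt_of_nonneg hcont hderiv hpos hlim]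
  simp [hF]

lemma integrableOn_one_sub_exp_neg_sq_div :
    IntegrableOn (fun t : ℝ => (1 - exp (-t ^ 2 / 2)) / t ^ 2) (Ioi 0) :=
  one_sub_exp_neg_sq_div_aux.1

lemma integral_one_sub_exp_neg_sq_div :
    ∫ t in Ioi (0 : ℝ), (1 - exp (-t ^ 2 / 2)) / t ^ 2 = √(π / 2) :=
  one_sub_exp_neg_sq_div_aux.2

/-- Change of variables `t ↦ c t` in a Lebesgue integral over the positive half line. -/
lemma lintegral_Ioi_comp_mul_left {f : ℝ → ENNReal} (hf : Measurable f) {c : ℝ} (hc : 0 < c) :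
    ∫⁻ t in Ioi 0, f (c * t) = ENNReal.ofReal c⁻¹ * ∫⁻ t in Ioi 0, f t := by
  have h := Real.map_volume_mul_left hc.ne'
  have hpre : (fun x => c * x) ⁻¹' Ioi 0 = Ioi 0 := by
    ext x; simp [hc]
  have h2 := setLIntegral_map (μ := (volume : Measure ℝ)) (measurableSet_Ioi (a := (0 : ℝ))) hf
    (measurable_const_mul c)
  rw [hpre] at h2
  rw [← h2, h, Measure.restrict_smul, lintegral_smul_measure, abs_of_pos (inv_pos.2 hc), smul_eq_mul]

lemma lintegral_one_sub_cos_mul (z : ℝ) :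
    ∫⁻ t in Ioi 0, ENNReal.ofReal ((1 - cos (t * z)) / t ^ 2) =
      ENNReal.ofReal |z| * ∫⁻ t in Ioi 0, ENNReal.ofReal ((1 - cos t) / t ^ 2) := by
  rcases eq_or_ne z 0 with rfl | hz
  · simp
  have hz' : 0 < |z| := abs_pos.2 hz
  have h := lintegral_Ioi_comp_mul_left (f := fun t => ENNReal.ofReal ((1 - cos t) / t ^ 2))
    (by fun_prop) hz'
  have h1 : ∀ t, ENNReal.ofReal ((1 - cos (t * z)) / t ^ 2) = ENNReal.ofReal (|z| ^ 2) *
      ENNReal.ofReal ((1 - cos (|z| * t)) / (|z| * t) ^ 2) := by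
    intro t
    rw [← ENNReal.ofReal_mul (by positivity)]
    congr 1
    have : cos (t * z) = cos (|z| * t) := by
      rw [← cos_abs (t * z), ← cos_abs (|z| * t), abs_mul, abs_mul, abs_abs, mul_comm]
    rw [this, mul_pow]
    rcases eq_or_ne t 0 with rfl | ht
    · simp
    field_simp
  simp only [h1]
  rw [lintegral_const_mul' _ _ ENNReal.ofReal_ne_top, h, ← mul_assoc,
    ← ENNReal.ofReal_mul (by positivity)]
  congr 2
  field_simp

/-- The first absolute moment in terms of the characteristic function, up to the value of the
constant `∫ (1 - cos t) / t²`. -/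
lemma lintegral_abs_mul_lintegral_one_sub_cos {α : Type*} [MeasurableSpace α] (ν : Measure α)
    [IsFiniteMeasure ν] {Z : α → ℝ} (hZ : Measurable Z) :
    (∫⁻ x, ENNReal.ofReal |Z x| ∂ν) * ∫⁻ t in Ioi 0, ENNReal.ofReal ((1 - cos t) / t ^ 2) =
      ∫⁻ t in Ioi 0, ENNReal.ofReal ((ν.real univ - ∫ x, cos (t * Z x) ∂ν) / t ^ 2) := by
  rw [← lintegral_mul_const _ (by fun_prop)]
  simp only [← lintegral_one_sub_cos_mul]
  rw [lintegral_lintegral_swap (by fun_prop)]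
  refine lintegral_congr fun t => ?_
  have hcos : Integrable (fun x => cos (t * Z x)) ν :=
    Integrable.of_bound (C := 1) (by fun_prop) (Eventually.of_forall fun x => by
      simpa using abs_cos_le_one _)
  rw [← ofReal_integral_eq_lintegral_ofReal]
  · rw [integral_div, integral_sub (integrable_const _) hcos]
    simp
  · exact ((integrable_const _).sub hcos).div_const _
  · exact Eventually.of_forall fun x => div_nonneg (by linarith [cos_le_one (t * Z x)]) (sq_nonneg t)

/-- The constant is the same for every distribution, so it is read off from the standard Gaussian,
where the first absolute moment is 2/√(2π) and the other side is √(π/2). -/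
lemma lintegral_one_sub_cos_div_sq :
    ∫⁻ t in Ioi 0, ENNReal.ofReal ((1 - cos t) / t ^ 2) = ENNReal.ofReal (π / 2) := by
  have h := lintegral_abs_mul_lintegral_one_sub_cos (ProbabilityTheory.gaussianReal 0 1)
    (measurable_id (α := ℝ))
  have hcos : ∀ t : ℝ, ∫ x, cos (t * x) ∂(ProbabilityTheory.gaussianReal 0 1) =
      exp (-t ^ 2 / 2) := by
    intro t
    have h1 := ProbabilityTheory.charFun_gaussianReal (μ := 0) (v := 1) t
    rw [charFun_apply_real] at h1
    have h2 := congrArg Complex.re h1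
    rw [← RCLike.re_eq_complex_re, ← integral_re] at h2
    · have h3 : ∀ x : ℝ, RCLike.re (Complex.exp (t * x * Complex.I)) = cos (t * x) := by
        intro x
        rw [RCLike.re_eq_complex_re, ← Complex.ofReal_mul, Complex.exp_ofReal_mul_I_re]
      simp only [h3] at h2
      rw [h2, RCLike.re_eq_complex_re]
      have : (t * (0 : ℝ) * Complex.I - ((1 : NNReal) : ℝ) * t ^ 2 / 2 : ℂ) =
          ((-t ^ 2 / 2 : ℝ) : ℂ) := by push_cast; ring
      rw [this, Complex.exp_ofReal_re]
    · refine Integrable.of_bound (C := 1) (by fun_prop) (Eventually.of_forall fun x => ?_)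
      rw [← Complex.ofReal_mul, Complex.norm_exp_ofReal_mul_I]
  have habs : ∫⁻ x, ENNReal.ofReal |x| ∂(ProbabilityTheory.gaussianReal 0 1) =
      ENNReal.ofReal ((√(2 * π))⁻¹ * 2) := by
    -- The Gaussian moment is again an integral of |g'| e^{-g}, with g = x²/2.
    have h1 := lintegral_abs_deriv_mul_exp_neg (g := fun x : ℝ => x ^ 2 / 2) (g' := fun x => x)
      (s₀ := 0) (fun s => by simpa using (hasDerivAt_pow 2 s).div_const 2)
      (fun s hs => hs.le) (fun s hs => hs.le)
      ((tendsto_pow_atTop two_ne_zero).atTop_div_const two_pos)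
      (by
        have := ((tendsto_pow_atTop (α := ℝ) two_ne_zero).comp
          tendsto_abs_atBot_atTop).atTop_div_const two_pos
        simpa using this)
    rw [ProbabilityTheory.gaussianReal_of_var_ne_zero _ one_ne_zero,
      lintegral_withDensity_eq_lintegral_mul _ (by fun_prop) (by fun_prop)]
    have h2 : ∀ x : ℝ, (ProbabilityTheory.gaussianPDF 0 1 * fun x : ℝ => ENNReal.ofReal |x|) x =
        ENNReal.ofReal (√(2 * π))⁻¹ * ENNReal.ofReal (|x| * exp (-(x ^ 2 / 2))) := by
      intro x
      rw [Pi.mul_apply, ProbabilityTheory.gaussianPDF,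
        ← ENNReal.ofReal_mul (ProbabilityTheory.gaussianPDFReal_nonneg _ _ _),
        ← ENNReal.ofReal_mul (by positivity)]
      congr 1
      simp only [ProbabilityTheory.gaussianPDFReal, NNReal.coe_one, sub_zero, mul_one]
      rw [neg_div]; ring
    simp only [h2]
    rw [lintegral_const_mul' _ _ ENNReal.ofReal_ne_top, h1, ← ENNReal.ofReal_mul (by positivity)]
    simp
  simp only [id, hcos, habs, probReal_univ] at h
  rw [← ofReal_integral_eq_lintegral_ofReal integrableOn_one_sub_exp_neg_sq_div
    (Eventually.of_forall one_sub_exp_neg_sq_div_nonneg), integral_one_sub_exp_neg_sq_div] at h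
  have hc : 0 < (√(2 * π))⁻¹ * 2 := by positivity
  have hval : √(π / 2) = (√(2 * π))⁻¹ * 2 * (π / 2) := by
    have h1 : √(π / 2) * √(2 * π) = π := by
      rw [← Real.sqrt_mul (by positivity), show π / 2 * (2 * π) = π ^ 2 by ring,
        Real.sqrt_sq pi_pos.le]
    have h2 : √(2 * π) ≠ 0 := by positivity
    rw [show (√(2 * π))⁻¹ * 2 * (π / 2) = (√(2 * π))⁻¹ * π by ring, eq_comm,
      inv_mul_eq_iff_eq_mul₀ h2, mul_comm, h1]
  rw [hval, ENNReal.ofReal_mul hc.le] at h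
  exact (ENNReal.mul_right_inj (by simpa using hc) ENNReal.ofReal_ne_top).1 h

lemma lintegral_abs_eq {α : Type*} [MeasurableSpace α] (ν : Measure α)
    [IsFiniteMeasure ν] {Z : α → ℝ} (hZ : Measurable Z) :
    (∫⁻ x, ENNReal.ofReal |Z x| ∂ν) * ENNReal.ofReal (π / 2) =
      ∫⁻ t in Ioi 0, ENNReal.ofReal ((ν.real univ - ∫ x, cos (t * Z x) ∂ν) / t ^ 2) := by
  rw [← lintegral_one_sub_cos_div_sq, lintegral_abs_mul_lintegral_one_sub_cos ν hZ]

/-! ### The density e^{-|x|^q} and its products -/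

/-- The total mass of `exp (-|x|^q)`. -/
def lqMass (q : ℝ) : ℝ := 2 * Gamma (1 / q + 1)

lemma lqMass_pos {q : ℝ} (hq : 0 < q) : 0 < lqMass q :=
  mul_pos two_pos (Gamma_pos_of_pos (by positivity))

lemma integral_exp_neg_abs_rpow {q : ℝ} (hq : 0 < q) :
    ∫ x : ℝ, exp (-|x| ^ q) = lqMass q := by
  rw [integral_comp_abs (f := fun x => exp (-x ^ q)), integral_exp_neg_rpow hq, lqMass]

lemma integrable_exp_neg_abs_rpow {q : ℝ} (hq : 0 < q) :
    Integrable fun x : ℝ => exp (-|x| ^ q) :=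
  Integrable.of_integral_ne_zero (by
    rw [integral_exp_neg_abs_rpow hq]; exact (lqMass_pos hq).ne')

/-- The probability measure with density proportional to `exp (-|x|^q)`. -/
def lqMeasure (q : ℝ) : Measure ℝ :=
  volume.withDensity fun x => ENNReal.ofReal (exp (-|x| ^ q) / lqMass q)

lemma isProbabilityMeasure_lqMeasure {q : ℝ} (hq : 0 < q) : IsProbabilityMeasure (lqMeasure q) := by
  constructor
  rw [lqMeasure, withDensity_apply _ MeasurableSet.univ, Measure.restrict_univ,
    ← ofReal_integral_eq_lintegral_ofReal ((integrable_exp_neg_abs_rpow hq).div_const _)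
      (Eventually.of_forall fun x => div_nonneg (exp_pos _).le (lqMass_pos hq).le),
    integral_div, integral_exp_neg_abs_rpow hq, div_self (lqMass_pos hq).ne', ENNReal.ofReal_one]

lemma integral_lqMeasure {E : Type*} [NormedAddCommGroup E] [NormedSpace ℝ E] {q : ℝ} (hq : 0 < q)
    (f : ℝ → E) :
    ∫ x, f x ∂lqMeasure q = (lqMass q)⁻¹ • ∫ x, exp (-|x| ^ q) • f x := by
  rw [lqMeasure, integral_withDensity_eq_integral_toReal_smul (by fun_prop) (by simp),
    ← integral_smul]
  congr 1; ext x
  rw [ENNReal.toReal_ofReal (div_nonneg (exp_pos _).le (lqMass_pos hq).le), smul_smul,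
    div_eq_inv_mul]

/-- The characteristic function of `xi q` under `lqMeasure q`. -/
def charXi (q t : ℝ) : ℝ := ∫ x, cos (t * xi q x) ∂lqMeasure q

/-- The density is even and `xi q` is odd, so the imaginary part vanishes. -/
lemma integral_cexp_xi {q : ℝ} (hq : 0 < q) (t : ℝ) :
    ∫ x, Complex.exp ((t * xi q x : ℝ) * Complex.I) ∂lqMeasure q = charXi q t := by
  have := isProbabilityMeasure_lqMeasure hq
  have hint : Integrable (fun x => Complex.exp ((t * xi q x : ℝ) * Complex.I)) (lqMeasure q) :=
    Integrable.of_bound (C := 1) (by fun_prop) (Eventually.of_forall fun x => by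
      rw [Complex.norm_exp_ofReal_mul_I])
  apply Complex.ext
  · rw [← RCLike.re_eq_complex_re, ← integral_re hint, RCLike.re_eq_complex_re, Complex.ofReal_re,
      charXi]
    simp only [Complex.exp_ofReal_mul_I_re]
  · rw [← RCLike.im_eq_complex_im, ← integral_im hint, RCLike.im_eq_complex_im, Complex.ofReal_im]
    simp only [Complex.exp_ofReal_mul_I_im]
    rw [integral_lqMeasure hq]
    have hodd : ∫ x : ℝ, exp (-|x| ^ q) • sin (t * xi q x) = 0 := by
      have h := integral_neg_eq_self (fun x : ℝ => exp (-|x| ^ q) • sin (t * xi q x)) volume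
      simp only [abs_neg, xi_neg, mul_neg, sin_neg, smul_neg, integral_neg] at h
      linarith
    rw [hodd, smul_zero]

section Product

variable {ι : Type*} [Fintype ι]

/-- The measure with density `exp (-∑ |x_i|^q)`. -/
def lqPiMeasure (ι : Type*) [Fintype ι] (q : ℝ) : Measure (ι → ℝ) :=
  volume.withDensity fun x => ENNReal.ofReal (exp (-∑ i, |x i| ^ q))

lemma integral_lqPiMeasure {E : Type*} [NormedAddCommGroup E] [NormedSpace ℝ E] (q : ℝ)
    (f : (ι → ℝ) → E) :
    ∫ x, f x ∂lqPiMeasure ι q = ∫ x, exp (-∑ i, |x i| ^ q) • f x := by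
  rw [lqPiMeasure, integral_withDensity_eq_integral_toReal_smul (by fun_prop) (by simp)]
  congr 1; ext x
  rw [ENNReal.toReal_ofReal (exp_pos _).le]

lemma integral_exp_neg_sum_abs_rpow {q : ℝ} (hq : 0 < q) :
    ∫ x : ι → ℝ, exp (-∑ i, |x i| ^ q) = lqMass q ^ Fintype.card ι := by
  have := integral_fintype_prod_volume_eq_pow (ι := ι) (fun x : ℝ => exp (-|x| ^ q))
  rw [integral_exp_neg_abs_rpow hq] at this
  rw [← this]
  congr 1; ext x
  rw [← Finset.sum_neg_distrib, exp_sum]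

lemma lqPiMeasure_univ {q : ℝ} (hq : 0 < q) :
    lqPiMeasure ι q univ = ENNReal.ofReal (lqMass q ^ Fintype.card ι) := by
  have hint : Integrable fun x : ι → ℝ => exp (-∑ i, |x i| ^ q) :=
    Integrable.of_integral_ne_zero (by
      rw [integral_exp_neg_sum_abs_rpow hq]; exact (pow_pos (lqMass_pos hq) _).ne')
  rw [lqPiMeasure, withDensity_apply _ MeasurableSet.univ, Measure.restrict_univ,
    ← ofReal_integral_eq_lintegral_ofReal hint (Eventually.of_forall fun x => (exp_pos _).le),
    integral_exp_neg_sum_abs_rpow hq]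

lemma isFiniteMeasure_lqPiMeasure {q : ℝ} (hq : 0 < q) : IsFiniteMeasure (lqPiMeasure ι q) :=
  ⟨by rw [lqPiMeasure_univ hq]; exact ENNReal.ofReal_lt_top⟩

lemma integral_cos_lqPiMeasure {q : ℝ} (hq : 0 < q) (a : ι → ℝ) :
    ∫ x, cos (∑ i, a i * xi q (x i)) ∂lqPiMeasure ι q =
      lqMass q ^ Fintype.card ι * ∏ i, charXi q (a i) := by
  have := isFiniteMeasure_lqPiMeasure (ι := ι) hq
  have hV := lqMass_pos hq
  have hint : Integrable (fun x : ι → ℝ =>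
      Complex.exp ((∑ i, a i * xi q (x i) : ℝ) * Complex.I)) (lqPiMeasure ι q) :=
    Integrable.of_bound (C := 1) (Measurable.aestronglyMeasurable (by fun_prop)) (Eventually.of_forall fun x => by
      rw [Complex.norm_exp_ofReal_mul_I])
  have hone : ∀ i, ∫ x : ℝ, (exp (-|x| ^ q) : ℂ) * Complex.exp ((a i * xi q x : ℝ) * Complex.I) =
      lqMass q * charXi q (a i) := by
    intro i
    rw [← integral_cexp_xi hq, integral_lqMeasure hq, ← Complex.real_smul, smul_smul,
      mul_inv_cancel₀ hV.ne', one_smul]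
    simp only [Complex.real_smul]
  have hprod := integral_fintype_prod_volume_eq_prod (𝕜 := ℂ) (ι := ι)
    (fun (i : ι) (x : ℝ) => (exp (-|x| ^ q) : ℂ) * Complex.exp ((a i * xi q x : ℝ) * Complex.I))
  simp only [hone] at hprod
  have hc : ∫ x, Complex.exp ((∑ i, a i * xi q (x i) : ℝ) * Complex.I) ∂lqPiMeasure ι q =
      ((lqMass q ^ Fintype.card ι * ∏ i, charXi q (a i) : ℝ) : ℂ) := by
    rw [integral_lqPiMeasure]
    have : ∀ x : ι → ℝ, exp (-∑ i, |x i| ^ q) •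
        Complex.exp ((∑ i, a i * xi q (x i) : ℝ) * Complex.I) =
        ∏ i, ((exp (-|x i| ^ q) : ℂ) * Complex.exp ((a i * xi q (x i) : ℝ) * Complex.I)) := by
      intro x
      rw [Finset.prod_mul_distrib, ← Complex.exp_sum, ← Finset.sum_neg_distrib, exp_sum,
        Complex.real_smul, Complex.ofReal_prod, Complex.ofReal_sum, Finset.sum_mul]
    simp only [this]
    rw [hprod, Finset.prod_mul_distrib, Finset.prod_const, Finset.card_univ]
    push_cast; rfl
  have hre := congrArg Complex.re hc
  rw [← RCLike.re_eq_complex_re, ← integral_re hint, RCLike.re_eq_complex_re,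
    Complex.ofReal_re] at hre
  simpa only [RCLike.re_eq_complex_re, Complex.exp_ofReal_mul_I_re] using hre

lemma abs_charXi_le_one {q : ℝ} (hq : 0 < q) (t : ℝ) : |charXi q t| ≤ 1 := by
  have := isProbabilityMeasure_lqMeasure hq
  have := norm_integral_le_of_norm_le_const (μ := lqMeasure q) (f := fun x => cos (t * xi q x))
    (C := 1) (Eventually.of_forall fun x => by simpa using abs_cos_le_one _)
  simpa [charXi] using this

lemma one_sub_prod_charXi_nonneg {q : ℝ} (hq : 0 < q) (a : ι → ℝ) :
    0 ≤ 1 - ∏ i, charXi q (a i) := by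
  have : |∏ i, charXi q (a i)| ≤ 1 := by
    rw [Finset.abs_prod]
    exact Finset.prod_le_one (fun _ _ => abs_nonneg _) fun i _ => abs_charXi_le_one hq _
  linarith [(abs_le.1 this).2]

lemma continuous_charXi {q : ℝ} (hq : 0 < q) : Continuous (charXi q) := by
  have := isProbabilityMeasure_lqMeasure hq
  refine continuous_of_dominated (bound := fun _ => 1) (fun t => by fun_prop)
    (fun t => Eventually.of_forall fun x => by simpa using abs_cos_le_one _)
    (integrable_const _) (Eventually.of_forall fun x => by fun_prop)

/-- Independence of the coordinates factors the characteristic function of the weighted sum, and the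
moment identity then applies to the unnormalised product measure. -/
lemma lintegral_abs_sum_xi {q : ℝ} (hq : 0 < q) (a : ι → ℝ) :
    (∫⁻ x : ι → ℝ, ENNReal.ofReal (|∑ i, a i * xi q (x i)| * exp (-∑ i, |x i| ^ q))) *
        ENNReal.ofReal (π / 2) =
      ENNReal.ofReal (lqMass q ^ Fintype.card ι) *
        ∫⁻ t in Ioi 0, ENNReal.ofReal ((1 - ∏ i, charXi q (t * a i)) / t ^ 2) := by
  have := isFiniteMeasure_lqPiMeasure (ι := ι) hq
  have hV := pow_pos (lqMass_pos hq) (Fintype.card ι)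
  have h := lintegral_abs_eq (lqPiMeasure ι q) (Z := fun x => ∑ i, a i * xi q (x i)) (by fun_prop)
  rw [lqPiMeasure, lintegral_withDensity_eq_lintegral_mul _ (by fun_prop) (by fun_prop),
    ← lqPiMeasure] at h
  have h1 : ∀ x : ι → ℝ, ENNReal.ofReal (|∑ i, a i * xi q (x i)| * exp (-∑ i, |x i| ^ q)) =
      ((fun x : ι → ℝ => ENNReal.ofReal (exp (-∑ i, |x i| ^ q))) *
        fun x : ι → ℝ => ENNReal.ofReal |∑ i, a i * xi q (x i)|) x := by
    intro x
    rw [Pi.mul_apply, ← ENNReal.ofReal_mul (exp_pos _).le, mul_comm]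
  simp only [h1]
  rw [h, ← lintegral_const_mul' _ _ ENNReal.ofReal_ne_top]
  refine lintegral_congr fun t => ?_
  rw [← ENNReal.ofReal_mul hV.le, measureReal_def, lqPiMeasure_univ hq,
    ENNReal.toReal_ofReal hV.le]
  have h2 : ∀ x : ι → ℝ, t * ∑ i, a i * xi q (x i) = ∑ i, (t * a i) * xi q (x i) := by
    intro x; simp only [Finset.mul_sum, mul_assoc]
  simp only [h2]
  rw [integral_cos_lqPiMeasure hq]
  congr 1; ring

end Product

/-! ### Diagonal directions -/

/-- `∫_0^∞ (1 - φ(t)^k) / t² dt`, which is `π / 2` times the first absolute moment of a sum of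
`k` independent copies of `xi q`. -/
def absMoment (q : ℝ) (k : ℕ) : ℝ := ∫ t in Ioi 0, (1 - charXi q t ^ k) / t ^ 2

lemma volume_lqBall {n : ℕ} {q : ℝ} (hq : 1 ≤ q) (hn : 1 ≤ n) :
    volume (lqBall n q) = ENNReal.ofReal (lqMass q ^ n / Gamma (n / q + 1)) := by
  have : Nonempty (Fin n) := ⟨⟨0, hn⟩⟩
  have h := volume_sum_rpow_le (Fin n) hq 1
  rw [ENNReal.ofReal_one, one_pow, one_mul, Fintype.card_fin] at h
  rw [lqMass, ← h, ← (PiLp.volume_preserving_ofLp (Fin n)).measure_preimage]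
  · congr 1
    ext x
    have hs : 0 ≤ ∑ i, |x i| ^ q := Finset.sum_nonneg fun i _ => by positivity
    simp only [lqBall, mem_preimage, mem_ofPred_eq]
    have h1 := Real.rpow_le_rpow_iff hs zero_le_one (by positivity : 0 < 1 / q)
    rw [Real.one_rpow] at h1
    exact h1.symm
  · refine (measurableSet_le ?_ measurable_const).nullMeasurableSet
    fun_prop

lemma norm_diagVec {n k : ℕ} (hk : 1 ≤ k) (hkn : k ≤ n) : ‖diagVec n k‖ = 1 := by
  rw [EuclideanSpace.norm_eq, Real.sqrt_eq_one]
  have h1 : ∀ i : Fin n, ‖(diagVec n k) i‖ ^ 2 = if (i : ℕ) < k then (1 / k : ℝ) else 0 := by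
    intro i
    simp only [diagVec]
    split_ifs
    · rw [Real.norm_eq_abs, sq_abs, div_pow, Real.sq_sqrt (by positivity), one_pow]
    · simp
  simp only [h1]
  rw [Fin.sum_univ_eq_sum_range (fun i => if i < k then (1 / k : ℝ) else 0), Finset.sum_ite,
    Finset.sum_const_zero, add_zero, Finset.sum_const]
  have : (Finset.range n).filter (· < k) = Finset.range k := by
    ext; simp; omega
  rw [this, Finset.card_range, nsmul_eq_mul]
  have : (0 : ℝ) < k := by exact_mod_cast hk
  field_simp

lemma prod_charXi_diagVec {q : ℝ} (hq : 0 < q) {n k : ℕ} (hkn : k ≤ n) (t : ℝ) :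
    ∏ i, charXi q (t * diagVec n k i) = charXi q (1 / √k * t) ^ k := by
  have := isProbabilityMeasure_lqMeasure hq
  have h0 : charXi q 0 = 1 := by simp [charXi]
  have h1 : ∀ i : Fin n, charXi q (t * diagVec n k i) =
      if (i : ℕ) < k then charXi q (1 / √k * t) else 1 := by
    intro i
    simp only [diagVec]
    split_ifs
    · rw [mul_comm]
    · rw [mul_zero, h0]
  simp only [h1]
  rw [Fin.prod_univ_eq_prod_range (fun i => if i < k then charXi q (1 / √k * t) else 1),
    Finset.prod_ite, Finset.prod_const_one, mul_one, Finset.prod_const]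
  congr 1
  have : (Finset.range n).filter (· < k) = Finset.range k := by
    ext; simp; omega
  rw [this, Finset.card_range]

/-- The projection function at diagonal directions in terms of the moments of sums of independent
random variables. -/
lemma projVol_diagVec {q : ℝ} (hq : 1 < q) {n k : ℕ} (hn : 2 ≤ n) (hk : 1 ≤ k) (hkn : k ≤ n) :
    projVol n q (diagVec n k) = Gamma (1 / q) * (2 / π) * (1 / √k) * absMoment q k := by
  have hq0 : 0 < q := by linarith
  have hV := lqMass_pos hq0
  have hk0 : (0 : ℝ) < √k := Real.sqrt_pos.2 (by exact_mod_cast hk)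
  have hΓ : 0 < Gamma ((n - 1 : ℕ) / q + 1) := Gamma_pos_of_pos (by positivity)
  have hproj := lintegral_eq_volume_proj_lqBall hq (norm_diagVec hk hkn) (by omega : 1 ≤ n)
  have hsum := lintegral_abs_sum_xi hq0 (diagVec n k).ofLp
  set v := volume ((Submodule.span ℝ {diagVec n k})ᗮ.orthogonalProjectionOnto '' lqBall n q)
  have hconv : ∫⁻ x : EuclideanSpace ℝ (Fin n),
        ENNReal.ofReal (|∑ i, diagVec n k i * (q * xi q (x i))| * exp (-powSum q x)) =
      ENNReal.ofReal q * ∫⁻ x : Fin n → ℝ, ENNReal.ofReal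
        (|∑ i, diagVec n k i * xi q (x i)| * exp (-∑ i, |x i| ^ q)) := by
    rw [← lintegral_const_mul' _ _ ENNReal.ofReal_ne_top,
      ← (PiLp.volume_preserving_ofLp (Fin n)).lintegral_comp (by fun_prop)]
    refine lintegral_congr fun x => ?_
    rw [← ENNReal.ofReal_mul hq0.le]
    congr 1
    have : ∑ i, diagVec n k i * (q * xi q (x i)) = q * ∑ i, diagVec n k i * xi q (x i) := by
      rw [Finset.mul_sum]; exact Finset.sum_congr rfl fun i _ => by ring
    rw [this, abs_mul, abs_of_pos hq0, mul_assoc]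
    rfl
  rw [hconv] at hproj
  set S := ∫⁻ x : Fin n → ℝ, ENNReal.ofReal
        (|∑ i, diagVec n k i * xi q (x i)| * exp (-∑ i, |x i| ^ q))
  have hA : (∫⁻ t in Ioi 0, ENNReal.ofReal
      ((1 - ∏ i, charXi q (t * diagVec n k i)) / t ^ 2)).toReal = 1 / √k * absMoment q k := by
    rw [← integral_eq_lintegral_of_nonneg_ae]
    · simp only [prod_charXi_diagVec hq0 hkn]
      have h := integral_comp_mul_left_Ioi (fun t => (1 - charXi q t ^ k) / t ^ 2) 0
        (b := 1 / √k) (by positivity)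
      rw [mul_zero, smul_eq_mul] at h
      rw [absMoment]
      have h2 : ∀ t : ℝ, (1 - charXi q (1 / √k * t) ^ k) / t ^ 2 =
          (1 / √k) ^ 2 * ((1 - charXi q (1 / √k * t) ^ k) / (1 / √k * t) ^ 2) := by
        intro t
        rcases eq_or_ne t 0 with rfl | ht
        · simp
        field_simp
      simp only [h2]
      rw [integral_const_mul, h]
      field_simp
    · exact Eventually.of_forall fun t =>
        div_nonneg (one_sub_prod_charXi_nonneg hq0 _) (sq_nonneg t)
    · have := (continuous_charXi hq0).measurable
      exact Measurable.aestronglyMeasurable (by fun_prop)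
  have hsum' := congrArg ENNReal.toReal hsum
  have hproj' := congrArg ENNReal.toReal hproj
  simp only [ENNReal.toReal_mul] at hsum' hproj'
  rw [hA, ENNReal.toReal_ofReal (by positivity), ENNReal.toReal_ofReal (by positivity),
    Fintype.card_fin] at hsum'
  rw [ENNReal.toReal_ofReal (by positivity), ENNReal.toReal_ofReal (by positivity)] at hproj'
  rw [projVol, volume_lqBall hq.le (by omega), ENNReal.toReal_ofReal (by positivity)]
  change v.toReal / _ = _
  have hv : v.toReal = q * S.toReal / (2 * Gamma ((n - 1 : ℕ) / q + 1)) := by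
    rw [eq_div_iff (by positivity), hproj', mul_comm]
  have hS : S.toReal = lqMass q ^ n * (1 / √k * absMoment q k) / (π / 2) := by
    rw [eq_div_iff (by positivity), hsum']
  have hG : Gamma (1 / q) = q * lqMass q / 2 := by
    rw [lqMass, Gamma_add_one (by positivity)]; field_simp
  -- The volume of the ball in dimension m cancels both the factor Γ(m/q + 1) and all but one power
  -- of the mass; the remaining q · `lqMass q` / 2 is Γ(1/q), so n drops out.
  obtain ⟨m, rfl⟩ : ∃ m, n = m + 1 := ⟨n - 1, by omega⟩
  simp only [Nat.add_sub_cancel] at hv hΓ ⊢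
  rw [hv, hS, hG, pow_succ]
  field_simp

/-- For fixed r the exponent |s + r|^q + |s - r|^q is even and convex in s, with minimum 2|r|^q at s
= 0, and the first factor is its derivative up to sign and the factor q. -/
lemma lintegral_abs_xi_add_xi_sub {q : ℝ} (hq : 1 < q) (r : ℝ) :
    ∫⁻ s : ℝ, ENNReal.ofReal (|xi q (s + r) + xi q (s - r)| *
        exp (-(|s + r| ^ q + |s - r| ^ q))) =
      ENNReal.ofReal (2 / q * exp (-(2 * |r| ^ q))) := by
  have hq0 : 0 < q := by linarith
  have hd : ∀ s : ℝ, HasDerivAt (fun s : ℝ => |s + r| ^ q + |s - r| ^ q)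
      (q * (xi q (s + r) + xi q (s - r))) s := by
    intro s
    have h1 := (hasDerivAt_abs_rpow_xi hq (s + r)).comp s ((hasDerivAt_id s).add_const r)
    have h2 := (hasDerivAt_abs_rpow_xi hq (s - r)).comp s ((hasDerivAt_id s).sub_const r)
    have h3 := h1.add h2
    simpa [Function.comp_def, mul_add] using! h3
  have hmono : Monotone fun s : ℝ => q * (xi q (s + r) + xi q (s - r)) := by
    intro s t hst
    have h1 := monotone_xi hq (by linarith : s + r ≤ t + r)
    have h2 := monotone_xi hq (by linarith : s - r ≤ t - r)
    simp only
    gcongr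
  have hzero : q * (xi q (0 + r) + xi q (0 - r)) = 0 := by
    rw [zero_add, zero_sub, xi_neg]; ring
  have htend : ∀ l : Filter ℝ, Tendsto (fun s : ℝ => |s|) l atTop → ∀ c : ℝ,
      Tendsto (fun s : ℝ => |s + c| ^ q) l atTop := by
    intro l hl c
    refine (tendsto_rpow_atTop hq0).comp (tendsto_atTop_mono (f := fun s => |s| + -|c|) (fun s => ?_)
      (tendsto_atTop_add_const_right _ _ hl))
    have := abs_add_le (s + c) (-c)
    rw [add_neg_cancel_right, abs_neg] at this
    linarith
  have hsum : ∀ l : Filter ℝ, Tendsto (fun s : ℝ => |s|) l atTop →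
      Tendsto (fun s : ℝ => |s + r| ^ q + |s - r| ^ q) l atTop := fun l hl =>
    (htend l hl r).atTop_add_atTop (by simpa [sub_eq_add_neg] using htend l hl (-r))
  have h := lintegral_abs_deriv_mul_exp_neg hd (s₀ := 0) (fun s hs => hzero ▸ hmono hs.le)
    (fun s hs => hzero ▸ hmono hs.le) (hsum _ tendsto_abs_atTop_atTop)
    (hsum _ tendsto_abs_atBot_atTop)
  have h1 : ∀ s : ℝ, ENNReal.ofReal (|xi q (s + r) + xi q (s - r)| *
        exp (-(|s + r| ^ q + |s - r| ^ q))) = ENNReal.ofReal q⁻¹ *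
        ENNReal.ofReal (|q * (xi q (s + r) + xi q (s - r))| *
        exp (-(|s + r| ^ q + |s - r| ^ q))) := by
    intro s
    rw [← ENNReal.ofReal_mul (by positivity), abs_mul, abs_of_pos hq0]
    congr 1; field_simp
  simp only [h1]
  rw [lintegral_const_mul' _ _ ENNReal.ofReal_ne_top, h, ← ENNReal.ofReal_mul (by positivity)]
  congr 1
  rw [zero_add, zero_sub, abs_neg]
  ring_nf

/-- The change of variables `(x, y) = (s + r, s - r)`. -/
lemma lintegral_prod_add_sub {F : ℝ × ℝ → ENNReal} (hF : Measurable F) :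
    ∫⁻ z, F z = 2 * ∫⁻ r : ℝ, ∫⁻ s : ℝ, F (s + r, s - r) := by
  rw [Measure.volume_eq_prod, lintegral_prod_symm' _ hF]
  have hscale : ∀ y : ℝ, ∫⁻ x, F (x, y) = 2 * ∫⁻ r : ℝ, F (2 * r + y, y) := by
    intro y
    rw [← lintegral_add_right_eq_self (μ := volume) (fun x : ℝ => F (x, y)) y]
    have h := lintegral_map (μ := (volume : Measure ℝ)) (f := fun x => F (x + y, y))
      (hF.comp (by fun_prop)) (measurable_const_mul (2 : ℝ))
    rw [← h, Real.map_volume_mul_left two_ne_zero, lintegral_smul_measure, smul_eq_mul, ← mul_assoc]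
    have : (2 : ENNReal) * ENNReal.ofReal |(2 : ℝ)⁻¹| = 1 := by
      rw [abs_of_pos (by norm_num), ENNReal.ofReal_inv_of_pos two_pos, ENNReal.ofReal_ofNat]
      exact ENNReal.mul_inv_cancel two_ne_zero (by simp)
    rw [this, one_mul]
  simp only [hscale]
  rw [lintegral_const_mul' _ _ (by simp), lintegral_lintegral_swap
    (f := fun y r => F (2 * r + y, y))
    (hF.comp (by fun_prop : Measurable fun z : ℝ × ℝ => (2 * z.2 + z.1, z.1))).aemeasurable]
  congr 1
  refine lintegral_congr fun r => ?_
  rw [← lintegral_sub_right_eq_self (μ := volume) (fun y : ℝ => F (2 * r + y, y)) r]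
  refine lintegral_congr fun s => ?_
  congr 2; ring

lemma absMoment_eq_toReal {q : ℝ} (hq : 0 < q) (k : ℕ) :
    absMoment q k =
      (∫⁻ t in Ioi 0, ENNReal.ofReal ((1 - charXi q t ^ k) / t ^ 2)).toReal := by
  rw [absMoment, integral_eq_lintegral_of_nonneg_ae]
  · refine Eventually.of_forall fun t => div_nonneg ?_ (sq_nonneg t)
    simpa using one_sub_prod_charXi_nonneg hq (fun _ : Fin k => t)
  · have := (continuous_charXi hq).measurable
    exact Measurable.aestronglyMeasurable (by fun_prop)

/-- In the coordinates x = s + r, y = s - r the s-integral is exact, which leaves only the integral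
of e^{-2|r|^q}. -/
lemma absMoment_two {q : ℝ} (hq : 1 < q) :
    absMoment q 2 = π / 2 * 2 ^ (1 - 1 / q) / Gamma (1 / q) := by
  have hq0 : 0 < q := by linarith
  have hV := lqMass_pos hq0
  have h := lintegral_abs_sum_xi hq0 (fun _ : Fin 2 => (1 : ℝ))
  have hS : ∫⁻ x : Fin 2 → ℝ, ENNReal.ofReal (|∑ i, (1 : ℝ) * xi q (x i)| * exp (-∑ i, |x i| ^ q)) =
      ENNReal.ofReal (4 / q * (2 ^ (-1 / q) * lqMass q)) := by
    have h1 := (volume_preserving_finTwoArrow ℝ).lintegral_comp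
      (f := fun z : ℝ × ℝ => ENNReal.ofReal (|xi q z.1 + xi q z.2| * exp (-(|z.1| ^ q + |z.2| ^ q))))
      (by fun_prop)
    simp only [Fin.sum_univ_two, one_mul]
    simp only [MeasurableEquiv.finTwoArrow_apply] at h1
    rw [h1, lintegral_prod_add_sub (by fun_prop)]
    simp only [lintegral_abs_xi_add_xi_sub hq]
    have hint : ∫ r : ℝ, exp (-(2 * |r| ^ q)) = 2 ^ (-1 / q) * lqMass q := by
      rw [integral_comp_abs (f := fun x => exp (-(2 * x ^ q)))]
      have := integral_exp_neg_mul_rpow hq0 (two_pos (α := ℝ))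
      simp only [neg_mul] at this
      rw [this, lqMass]
      ring
    rw [← ofReal_integral_eq_lintegral_ofReal, integral_const_mul, hint,
      ← ENNReal.ofReal_ofNat, ← ENNReal.ofReal_mul (by norm_num)]
    · congr 1; ring
    · refine Integrable.const_mul (Integrable.of_integral_ne_zero ?_) _
      rw [hint]; positivity
    · exact Eventually.of_forall fun r => by positivity
  rw [hS] at h
  have h' := congrArg ENNReal.toReal h
  simp only [mul_one, Finset.prod_const, Finset.card_univ, Fintype.card_fin,
    ENNReal.toReal_mul] at h'
  rw [← absMoment_eq_toReal hq0, ENNReal.toReal_ofReal (by positivity),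
    ENNReal.toReal_ofReal (by positivity), ENNReal.toReal_ofReal (by positivity)] at h'
  have hG : Gamma (1 / q) = q * lqMass q / 2 := by
    rw [lqMass, Gamma_add_one (by positivity)]; field_simp
  have h2 : (2 : ℝ) ^ (1 - 1 / q) = 2 * 2 ^ (-1 / q) := by
    rw [sub_eq_add_neg, Real.rpow_add two_pos, Real.rpow_one, neg_div]
  rw [hG, h2]
  have : absMoment q 2 = 4 / q * (2 ^ (-1 / q) * lqMass q) * (π / 2) / lqMass q ^ 2 := by
    rw [eq_div_iff (by positivity), h', mul_comm]
  rw [this]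
  field_simp
  ring

/-! ### Normalisation and the limit by the central limit theorem -/

/-- The standard deviation of `xi q` under `lqMeasure q`. -/
def sdXi (q : ℝ) : ℝ := √(Gamma (2 - 1 / q) / Gamma (1 / q))

lemma sdXi_pos {q : ℝ} (hq : 1 < q) : 0 < sdXi q := by
  have h1 : 1 / q < 1 := by rw [div_lt_one (by linarith)]; exact hq
  have h2 : 0 < 1 / q := by positivity
  exact Real.sqrt_pos.2 (div_pos (Gamma_pos_of_pos (by linarith)) (Gamma_pos_of_pos h2))

lemma xi_sq {q : ℝ} (hq : 1 < q) (x : ℝ) : xi q x ^ 2 = |x| ^ (2 * q - 2) := by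
  rw [← sq_abs, abs_xi hq, ← Real.rpow_natCast, ← Real.rpow_mul (abs_nonneg x)]
  congr 1; push_cast; ring

lemma integral_xi_sq_mul_exp {q : ℝ} (hq : 1 < q) :
    ∫ x : ℝ, exp (-|x| ^ q) * xi q x ^ 2 = 2 / q * Gamma (2 - 1 / q) := by
  simp only [xi_sq hq]
  rw [integral_comp_abs (f := fun x => exp (-x ^ q) * x ^ (2 * q - 2))]
  have := integral_rpow_mul_exp_neg_rpow (p := q) (q := 2 * q - 2) (by linarith) (by linarith)
  simp only [mul_comm (exp _)]
  rw [this, show (2 * q - 2 + 1) / q = 2 - 1 / q by field_simp; ring]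
  ring

lemma sdXi_sq {q : ℝ} (hq : 1 < q) : sdXi q ^ 2 = Gamma (2 - 1 / q) / Gamma (1 / q) := by
  have h1 : 1 / q < 1 := by rw [div_lt_one (by linarith)]; exact hq
  have h2 : 0 < 1 / q := by positivity
  rw [sdXi, Real.sq_sqrt
    (div_pos (Gamma_pos_of_pos (by linarith)) (Gamma_pos_of_pos h2)).le]

lemma integral_xi_sq {q : ℝ} (hq : 1 < q) : ∫ x, xi q x ^ 2 ∂lqMeasure q = sdXi q ^ 2 := by
  have hq0 : 0 < q := by linarith
  have hΓ : Gamma (1 / q) ≠ 0 := (Gamma_pos_of_pos (by positivity)).ne'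
  rw [integral_lqMeasure hq0, sdXi_sq hq]
  simp only [smul_eq_mul]
  rw [integral_xi_sq_mul_exp hq, lqMass, Gamma_add_one (by positivity)]
  field_simp

lemma integral_xi {q : ℝ} (hq : 0 < q) : ∫ x, xi q x ∂lqMeasure q = 0 := by
  rw [integral_lqMeasure hq]
  have h := integral_neg_eq_self (fun x : ℝ => exp (-|x| ^ q) • xi q x) volume
  simp only [abs_neg, xi_neg, smul_neg, integral_neg] at h
  have : ∫ x : ℝ, exp (-|x| ^ q) • xi q x = 0 := by linarith
  rw [this, smul_zero]

/-- The characteristic function of the normalised variable `xi q / sdXi q`. -/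
def charNorm (q u : ℝ) : ℝ := charXi q (u / sdXi q)

lemma charNorm_eq (q u : ℝ) :
    charNorm q u = ∫ x, cos (u * (xi q x / sdXi q)) ∂lqMeasure q := by
  simp only [charNorm, charXi]
  congr 1; ext x; congr 1; ring

lemma abs_charNorm_le_one {q : ℝ} (hq : 0 < q) (u : ℝ) : |charNorm q u| ≤ 1 :=
  abs_charXi_le_one hq _

lemma continuous_charNorm {q : ℝ} (hq : 0 < q) : Continuous (charNorm q) :=
  (continuous_charXi hq).comp (by fun_prop)

lemma integral_xi_div_sdXi_sq {q : ℝ} (hq : 1 < q) :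
    ∫ x, (xi q x / sdXi q) ^ 2 ∂lqMeasure q = 1 := by
  have := sdXi_pos hq
  simp only [div_pow]
  rw [integral_div, integral_xi_sq hq, div_self (by positivity)]

/-- A quadratic minorant of the cosine gives a quadratic minorant of the normalised
characteristic function. -/
lemma le_charNorm_of_le_cos {q : ℝ} (hq : 1 < q) {α β u : ℝ}
    (h : ∀ y, α - β * y ^ 2 ≤ cos y) : α - β * u ^ 2 ≤ charNorm q u := by
  have := isProbabilityMeasure_lqMeasure (by linarith : 0 < q)
  have hint : Integrable (fun x => (xi q x / sdXi q) ^ 2) (lqMeasure q) :=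
    Integrable.of_integral_ne_zero (by rw [integral_xi_div_sdXi_sq hq]; exact one_ne_zero)
  have h1 : ∫ x, (α - β * u ^ 2 * (xi q x / sdXi q) ^ 2) ∂lqMeasure q = α - β * u ^ 2 := by
    rw [integral_sub (integrable_const _) (hint.const_mul _), integral_const_mul,
      integral_xi_div_sdXi_sq hq]
    simp
  rw [← h1, charNorm_eq]
  refine integral_mono ((integrable_const _).sub (hint.const_mul _))
    (Integrable.of_bound (C := 1) (by fun_prop) (Eventually.of_forall fun x => by
      simpa using abs_cos_le_one _)) fun x => ?_
  have := h (u * (xi q x / sdXi q))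
  rw [mul_pow, ← mul_assoc] at this
  exact this

lemma one_sub_sq_div_two_le_charNorm {q : ℝ} (hq : 1 < q) (u : ℝ) :
    1 - u ^ 2 / 2 ≤ charNorm q u := by
  have := le_charNorm_of_le_cos hq (α := 1) (β := 1 / 2) (u := u) fun y => by
    have := one_sub_sq_div_two_le_cos (x := y); linarith
  linarith

lemma absMoment_eq {q : ℝ} (hq : 1 < q) (n : ℕ) :
    absMoment q n = sdXi q * ∫ u in Ioi 0, (1 - charNorm q u ^ n) / u ^ 2 := by
  have hσ := sdXi_pos hq
  have h := integral_comp_mul_left_Ioi (fun t => (1 - charXi q t ^ n) / t ^ 2) 0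
    (b := (sdXi q)⁻¹) (by positivity)
  rw [mul_zero, smul_eq_mul, inv_inv] at h
  have h1 : ∀ u : ℝ, (1 - charNorm q u ^ n) / u ^ 2 = (sdXi q)⁻¹ ^ 2 *
      ((1 - charXi q ((sdXi q)⁻¹ * u) ^ n) / ((sdXi q)⁻¹ * u) ^ 2) := by
    intro u
    rw [charNorm, div_eq_inv_mul u]
    rcases eq_or_ne u 0 with rfl | hu
    · simp
    field_simp
  simp only [h1]
  rw [integral_const_mul, h, absMoment]
  field_simp

lemma integral_charNorm_pow_div_sqrt {q : ℝ} {n : ℕ} (hn : 1 ≤ n) :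
    (∫ u in Ioi 0, (1 - charNorm q u ^ n) / u ^ 2) / √n =
      ∫ u in Ioi 0, (1 - charNorm q ((√n)⁻¹ * u) ^ n) / u ^ 2 := by
  have hn0 : (0 : ℝ) < √n := Real.sqrt_pos.2 (by exact_mod_cast hn)
  have h := integral_comp_mul_left_Ioi (fun t => (1 - charNorm q t ^ n) / t ^ 2) 0
    (b := (√n)⁻¹) (by positivity)
  rw [mul_zero, smul_eq_mul, inv_inv] at h
  have h1 : ∀ u : ℝ, (1 - charNorm q ((√n)⁻¹ * u) ^ n) / u ^ 2 = (√n)⁻¹ ^ 2 *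
      ((1 - charNorm q ((√n)⁻¹ * u) ^ n) / ((√n)⁻¹ * u) ^ 2) := by
    intro u
    rcases eq_or_ne u 0 with rfl | hu
    · simp
    field_simp
  simp only [h1]
  rw [integral_const_mul, h]
  field_simp

lemma tendsto_charNorm_pow {q : ℝ} (hq : 1 < q) (t : ℝ) :
    Tendsto (fun n : ℕ => charNorm q ((√n)⁻¹ * t) ^ n) atTop (𝓝 (exp (-t ^ 2 / 2))) := by
  have hq0 : 0 < q := by linarith
  have := isProbabilityMeasure_lqMeasure hq0
  have h := ProbabilityTheory.tendsto_charFun_inv_sqrt_mul_pow (P := lqMeasure q)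
    (X := fun x => xi q x / sdXi q) (by fun_prop)
    (by rw [integral_div, integral_xi hq0, zero_div]) (integral_xi_div_sdXi_sq hq) t
  have hchar : ∀ u : ℝ, charFun ((lqMeasure q).map fun x => xi q x / sdXi q) u =
      (charNorm q u : ℂ) := by
    intro u
    rw [charFun_apply_real, integral_map (by fun_prop) (by fun_prop), charNorm,
      ← integral_cexp_xi hq0]
    congr 1; ext x; congr 1; push_cast; ring
  simp only [hchar] at h
  have h2 := (Complex.continuous_re.tendsto _).comp h
  have h3 : Complex.exp (-(t : ℂ) ^ 2 / 2) = ((exp (-t ^ 2 / 2) : ℝ) : ℂ) := by push_cast; rfl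
  rw [h3, Complex.ofReal_re] at h2
  refine h2.congr fun n => ?_
  simp only [Function.comp_apply]
  rw [← Complex.ofReal_pow, Complex.ofReal_re]

/-- Bernoulli's inequality applied to the bound 1 - u²/2. After u is rescaled by 1/√n the right side
no longer depends on n, which permits dominated convergence. -/
lemma one_sub_charNorm_pow_le {q : ℝ} (hq : 1 < q) (n : ℕ) (u : ℝ) :
    1 - charNorm q u ^ n ≤ n * (u ^ 2 / 2) := by
  have h1 := one_sub_sq_div_two_le_charNorm hq u
  have h2 := abs_le.1 (abs_charNorm_le_one (by linarith : 0 < q) u)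
  have h3 := one_add_mul_le_pow (a := charNorm q u - 1) (by linarith) n
  rw [add_sub_cancel] at h3
  have : (n : ℝ) * (1 - charNorm q u) ≤ n * (u ^ 2 / 2) :=
    mul_le_mul_of_nonneg_left (by linarith) (Nat.cast_nonneg n)
  linarith

lemma tendsto_absMoment_div_sqrt {q : ℝ} (hq : 1 < q) :
    Tendsto (fun n : ℕ => absMoment q n / √n) atTop (𝓝 (sdXi q * √(π / 2))) := by
  have hq0 : 0 < q := by linarith
  have hmain : Tendsto (fun n : ℕ => ∫ u in Ioi 0, (1 - charNorm q ((√n)⁻¹ * u) ^ n) / u ^ 2) atTop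
      (𝓝 √(π / 2)) := by
    rw [← integral_one_sub_exp_neg_sq_div]
    -- The numerator is at most u²/2 and at most 2. The first bound gives the majorant for u² ≤ 4,
    -- the second for u² ≥ 4.
    refine tendsto_integral_filter_of_dominated_convergence (fun u => 3 * (1 + u ^ 2)⁻¹) ?_ ?_ ?_ ?_
    · refine Eventually.of_forall fun n => ?_
      have := (continuous_charNorm hq0).measurable
      exact Measurable.aestronglyMeasurable (by fun_prop)
    · filter_upwards [eventually_ge_atTop 1] with n hn
      filter_upwards [ae_restrict_mem measurableSet_Ioi] with u hu
      have hu0 : (0 : ℝ) < u := hu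
      have hn0 : (0 : ℝ) < n := by exact_mod_cast hn
      have h1 := one_sub_charNorm_pow_le hq n ((√n)⁻¹ * u)
      have h2 : |charNorm q ((√n)⁻¹ * u) ^ n| ≤ 1 := by
        rw [abs_pow]; exact pow_le_one₀ (abs_nonneg _) (abs_charNorm_le_one hq0 _)
      rw [abs_le] at h2
      have h3 : (n : ℝ) * (((√n)⁻¹ * u) ^ 2 / 2) = u ^ 2 / 2 := by
        rw [mul_pow, inv_pow, Real.sq_sqrt hn0.le]; field_simp
      rw [h3] at h1
      rw [Real.norm_eq_abs, abs_of_nonneg (div_nonneg (by linarith [h2.2]) (sq_nonneg u)),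
        div_le_iff₀ (by positivity), ← div_eq_mul_inv, div_mul_eq_mul_div, le_div_iff₀ (by positivity)]
      have hu2 := sq_pos_of_pos hu0
      rcases le_total (u ^ 2) 4 with h | h
      · nlinarith
      · nlinarith [h2.1]
    · exact (integrable_inv_one_add_sq.const_mul 3).integrableOn
    · filter_upwards with u
      exact ((tendsto_const_nhds.sub (tendsto_charNorm_pow hq u)).div_const _)
  have := hmain.const_mul (sdXi q)
  refine this.congr' ?_
  filter_upwards [eventually_ge_atTop 1] with n hn
  rw [← integral_charNorm_pow_div_sqrt hn, absMoment_eq hq, mul_div_assoc]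

/-! ### Wallis integrals -/

/-- `∫_0^{√2} (1 - u²/2)^k du`. -/
def wallisInt (k : ℕ) : ℝ := ∫ u in (0 : ℝ)..√2, (1 - u ^ 2 / 2) ^ k

lemma wallisInt_zero : wallisInt 0 = √2 := by simp [wallisInt]

/-- Integrate the derivative of u (1 - u²/2)^(k+1), a function that vanishes at both 0 and √2. -/
lemma wallisInt_succ (k : ℕ) : (2 * k + 3) * wallisInt (k + 1) = (2 * k + 2) * wallisInt k := by
  have hd : ∀ u : ℝ, HasDerivAt (fun u : ℝ => u * (1 - u ^ 2 / 2) ^ (k + 1))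
      ((2 * k + 3) * (1 - u ^ 2 / 2) ^ (k + 1) - (2 * k + 2) * (1 - u ^ 2 / 2) ^ k) u := by
    intro u
    have h1 : HasDerivAt (fun u : ℝ => 1 - u ^ 2 / 2) (-u) u := by
      have := ((hasDerivAt_pow 2 u).div_const 2).const_sub 1
      simpa using this
    have h2 := (hasDerivAt_id u).mul (h1.pow (k + 1))
    convert! h2 using 1
    simp only [Nat.add_sub_cancel, id, Pi.pow_apply]
    push_cast
    ring
  have h := intervalIntegral.integral_eq_sub_of_hasDerivAt (a := 0) (b := √2)
    (fun u _ => hd u) (Continuous.intervalIntegrable (by fun_prop) _ _)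
  rw [intervalIntegral.integral_sub (Continuous.intervalIntegrable (by fun_prop) _ _)
    (Continuous.intervalIntegrable (by fun_prop) _ _), intervalIntegral.integral_const_mul,
    intervalIntegral.integral_const_mul, Real.sq_sqrt zero_le_two] at h
  simp at h
  unfold wallisInt
  linarith

lemma wallisInt_sq (k : ℕ) : wallisInt k ^ 2 = 2 * Wallis.W k / (2 * k + 1) := by
  induction k with
  | zero => simp [wallisInt_zero, Wallis.W]
  | succ k ih =>
    have h := wallisInt_succ k
    have h1 : wallisInt (k + 1) = (2 * k + 2) * wallisInt k / (2 * k + 3) := by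
      field_simp; linarith
    rw [h1, div_pow, mul_pow, ih, Wallis.W_succ]
    push_cast
    field_simp
    ring

/-- The left side increases in k to its limit π/2, by Wallis' product. The shift 3/4 is the largest
for which it is monotone: a larger one makes it eventually decreasing. -/
lemma wallisInt_sq_mul_le (k : ℕ) : wallisInt k ^ 2 * (k + 3 / 4) ≤ π / 2 := by
  have heq : ∀ k : ℕ, wallisInt k ^ 2 * (k + 3 / 4) =
      Wallis.W k * ((2 * k + 3 / 2) / (2 * k + 1)) := by
    intro k; rw [wallisInt_sq]; field_simp; ring
  have hmono : Monotone fun k : ℕ => wallisInt k ^ 2 * ((k : ℝ) + 3 / 4) := by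
    refine monotone_nat_of_le_succ fun k => ?_
    rw [heq, heq, Wallis.W_succ, mul_assoc]
    refine mul_le_mul_of_nonneg_left ?_ (Wallis.W_pos k).le
    push_cast
    rw [div_mul_div_comm, div_mul_div_comm, div_le_div_iff₀ (by positivity) (by positivity)]
    have hk : (0 : ℝ) ≤ k := Nat.cast_nonneg k
    have h1 : (2 * (k : ℝ) + 3 / 2) * (2 * k + 3) ^ 2 ≤ (2 * k + 2) ^ 2 * (2 * k + 7 / 2) := by
      nlinarith [sq_nonneg (k : ℝ)]
    have h2 := mul_le_mul_of_nonneg_left h1 (by positivity : 0 ≤ 2 * (k : ℝ) + 1)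
    nlinarith [h2]
  have hlim : Tendsto (fun k : ℕ => wallisInt k ^ 2 * ((k : ℝ) + 3 / 4)) atTop (𝓝 (π / 2)) := by
    simp only [heq]
    have h1 : Tendsto (fun k : ℕ => (2 * (k : ℝ) + 3 / 2) / (2 * k + 1)) atTop (𝓝 1) := by
      have h2 : Tendsto (fun k : ℕ => 1 + (1 / 2 : ℝ) / (2 * k + 1)) atTop (𝓝 (1 + 0)) := by
        refine tendsto_const_nhds.add (Tendsto.div_atTop tendsto_const_nhds ?_)
        exact tendsto_atTop_add_const_right _ _
          (tendsto_natCast_atTop_atTop.const_mul_atTop two_pos)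
      rw [add_zero] at h2
      refine h2.congr fun k => ?_
      field_simp; ring
    simpa using Wallis.tendsto_W_nhds_pi_div_two.mul h1
  exact hmono.ge_of_tendsto hlim k

/-- The sum comes from expanding (1 - (1 - u²/2)^n) / u² as a geometric sum on (0, √2], and 1/√2 is
the integral of 1/u² beyond √2. The recursion collapses the total to a single Wallis integral. -/
lemma sum_wallisInt {n : ℕ} (hn : 1 ≤ n) :
    1 / 2 * ∑ k ∈ Finset.range n, wallisInt k + 1 / √2 = n * wallisInt (n - 1) := by
  induction n, hn using Nat.le_induction with
  | base =>
    have := Real.sq_sqrt (zero_le_two (α := ℝ))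
    have h2 : √2 ≠ 0 := by positivity
    simp [wallisInt_zero]
    field_simp
    linarith
  | succ n hn ih =>
    obtain ⟨m, rfl⟩ : ∃ m, n = m + 1 := ⟨n - 1, by omega⟩
    rw [Finset.sum_range_succ]
    have h := wallisInt_succ m
    simp only [Nat.add_sub_cancel] at ih ⊢
    push_cast at ih ⊢
    linarith

lemma integral_Ioc_one_sub_pow_div_sq (n : ℕ) :
    IntegrableOn (fun u : ℝ => (1 - (1 - u ^ 2 / 2) ^ n) / u ^ 2) (Ioc 0 √2) ∧
    ∫ u in Ioc 0 √2, (1 - (1 - u ^ 2 / 2) ^ n) / u ^ 2 =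
      1 / 2 * ∑ k ∈ Finset.range n, wallisInt k := by
  have h : EqOn (fun u : ℝ => 1 / 2 * ∑ k ∈ Finset.range n, (1 - u ^ 2 / 2) ^ k)
      (fun u : ℝ => (1 - (1 - u ^ 2 / 2) ^ n) / u ^ 2) (Ioc 0 √2) := by
    intro u hu
    have hu0 : u ≠ 0 := ne_of_gt hu.1
    have := geom_sum_mul (1 - u ^ 2 / 2) n
    simp only
    rw [eq_div_iff (by positivity)]
    linarith
  have hc : Continuous fun u : ℝ => 1 / 2 * ∑ k ∈ Finset.range n, (1 - u ^ 2 / 2) ^ k := by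
    fun_prop
  constructor
  · refine IntegrableOn.congr_fun ?_ h measurableSet_Ioc
    exact (hc.integrableOn_Icc).mono_set Ioc_subset_Icc_self
  · rw [← setIntegral_congr_fun measurableSet_Ioc h,
      ← intervalIntegral.integral_of_le (by positivity), intervalIntegral.integral_const_mul,
      intervalIntegral.integral_finsetSum fun i _ => Continuous.intervalIntegrable (by fun_prop) _ _]
    rfl

lemma setIntegral_Ioc_const_div_sq {a b : ℝ} (ha : 0 < a) (hab : a ≤ b) (c : ℝ) :
    IntegrableOn (fun u : ℝ => c / u ^ 2) (Ioc a b) ∧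
    ∫ u in Ioc a b, c / u ^ 2 = c * (1 / a - 1 / b) := by
  have hcont : ContinuousOn (fun u : ℝ => c / u ^ 2) (uIcc a b) := by
    rw [uIcc_of_le hab]
    refine continuousOn_const.div (by fun_prop) fun u hu => ?_
    exact pow_ne_zero _ (ha.trans_le hu.1).ne'
  have hint := hcont.intervalIntegrable (μ := volume)
  refine ⟨(intervalIntegrable_iff_integrableOn_Ioc_of_le hab).1 hint, ?_⟩
  rw [← intervalIntegral.integral_of_le hab,
    intervalIntegral.integral_eq_sub_of_hasDerivAt (f := fun u => -(c * u⁻¹)) _ hint]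
  · simp only [one_div]; ring
  · intro u hu
    rw [uIcc_of_le hab] at hu
    have hu0 : u ≠ 0 := (ha.trans_le hu.1).ne'
    have := ((hasDerivAt_inv hu0).const_mul c).neg
    convert! this using 1
    field_simp

lemma setIntegral_Ioi_one_add_pow_div_sq {c : ℝ} (hc : 0 < c) (n : ℕ) :
    IntegrableOn (fun u : ℝ => (1 + (c / u) ^ n) / u ^ 2) (Ioi c) ∧
    ∫ u in Ioi c, (1 + (c / u) ^ n) / u ^ 2 = 1 / c + 1 / (c * (n + 1)) := by
  set F : ℝ → ℝ := fun u => -(u⁻¹) - c ^ n / (n + 1) * u⁻¹ ^ (n + 1)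
  have hd : ∀ u ∈ Ici c, HasDerivAt F ((1 + (c / u) ^ n) / u ^ 2) u := by
    intro u hu
    have hu0 : u ≠ 0 := (hc.trans_le hu).ne'
    have h1 := hasDerivAt_inv hu0
    have h2 := h1.neg.sub ((h1.pow (n + 1)).const_mul (c ^ n / (n + 1)))
    convert! h2 using 1
    simp only [Nat.add_sub_cancel]
    push_cast
    rw [div_pow, inv_pow]
    field_simp
    ring
  have hpos : ∀ u ∈ Ioi c, 0 ≤ (1 + (c / u) ^ n) / u ^ 2 := fun u hu => by
    have : 0 < u := hc.trans hu
    positivity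
  have hlim : Tendsto F atTop (𝓝 0) := by
    have h1 : Tendsto (fun u : ℝ => u⁻¹) atTop (𝓝 0) := tendsto_inv_atTop_zero
    have h2 := h1.neg.sub ((h1.pow (n + 1)).const_mul (c ^ n / (n + 1)))
    simpa [F] using h2
  refine ⟨integrableOn_Ioi_deriv_of_nonneg' hd hpos hlim, ?_⟩
  rw [integral_Ioi_of_hasDerivAt_of_nonneg' hd hpos hlim]
  simp only [F]
  have h3 : c ^ n * c⁻¹ ^ (n + 1) = c⁻¹ := by
    rw [pow_succ, ← mul_assoc, ← mul_pow, mul_inv_cancel₀ hc.ne', one_pow, one_mul]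
  rw [div_mul_eq_mul_div, h3]
  field_simp
  ring

/-! ### Upper bound for the n-fold moment -/

/-- Lower bounds for a characteristic function give an upper bound for the corresponding first
absolute moment. -/
lemma integral_one_sub_pow_div_sq_le {Φ : ℝ → ℝ} {n : ℕ} (hn : 1 ≤ n) {u₁ u₂ r₁ r₂ : ℝ}
    (hint : IntegrableOn (fun u => (1 - Φ u ^ n) / u ^ 2) (Ioi 0))
    (h0 : ∀ u, 1 - u ^ 2 / 2 ≤ Φ u) (hle : ∀ u, |Φ u| ≤ 1)
    (hu₁ : √2 ≤ u₁) (hu₂ : u₁ ≤ u₂) (hr₁ : 0 ≤ r₁) (hr₂ : 0 ≤ r₂)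
    (h1 : ∀ u, 0 ≤ u → u ≤ u₁ → -r₁ ≤ Φ u) (h2 : ∀ u, 0 ≤ u → u ≤ u₂ → -r₂ ≤ Φ u)
    (h3 : ∀ u, 0 < u → |Φ u| ≤ u₂ / u) :
    ∫ u in Ioi 0, (1 - Φ u ^ n) / u ^ 2 ≤ n * wallisInt (n - 1) +
      (r₁ ^ n * (1 / √2 - 1 / u₁) + r₂ ^ n * (1 / u₁ - 1 / u₂) + 1 / (u₂ * (n + 1))) := by
  have hs : (0 : ℝ) < √2 := by positivity
  have hu₁0 : 0 < u₁ := hs.trans_le hu₁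
  have hu₂0 : 0 < u₂ := hu₁0.trans_le hu₂
  have hpow : ∀ {x r : ℝ}, 0 ≤ r → |x| ≤ 1 → -r ≤ x → -r ^ n ≤ x ^ n := by
    intro x r hr hx hrx
    rcases le_total 0 x with h | h
    · have := pow_nonneg h n
      have := pow_nonneg hr n
      linarith
    · have h4 : |x| ^ n ≤ r ^ n := pow_le_pow_left₀ (abs_nonneg x) (by
        rw [abs_of_nonpos h]; linarith) n
      rw [← abs_pow] at h4
      linarith [neg_abs_le (x ^ n)]
  have i1 : IntegrableOn (fun u => (1 - Φ u ^ n) / u ^ 2) (Ioi √2) :=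
    hint.mono_set (Ioi_subset_Ioi hs.le)
  have i2 : IntegrableOn (fun u => (1 - Φ u ^ n) / u ^ 2) (Ioi u₁) :=
    hint.mono_set (Ioi_subset_Ioi hu₁0.le)
  have i3 : IntegrableOn (fun u => (1 - Φ u ^ n) / u ^ 2) (Ioi u₂) :=
    hint.mono_set (Ioi_subset_Ioi hu₂0.le)
  have hdecomp : ∫ u in Ioi 0, (1 - Φ u ^ n) / u ^ 2 =
      (∫ u in Ioc 0 √2, (1 - Φ u ^ n) / u ^ 2) + ((∫ u in Ioc √2 u₁, (1 - Φ u ^ n) / u ^ 2) +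
      ((∫ u in Ioc u₁ u₂, (1 - Φ u ^ n) / u ^ 2) + ∫ u in Ioi u₂, (1 - Φ u ^ n) / u ^ 2)) := by
    rw [← setIntegral_union (Ioc_disjoint_Ioi le_rfl) measurableSet_Ioi
        (i2.mono_set Ioc_subset_Ioi_self) i3, Ioc_union_Ioi_eq_Ioi hu₂,
      ← setIntegral_union (Ioc_disjoint_Ioi le_rfl) measurableSet_Ioi
        (i1.mono_set Ioc_subset_Ioi_self) i2, Ioc_union_Ioi_eq_Ioi hu₁,
      ← setIntegral_union (Ioc_disjoint_Ioi le_rfl) measurableSet_Ioi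
        (hint.mono_set Ioc_subset_Ioi_self) i1, Ioc_union_Ioi_eq_Ioi hs.le]
  have b1 : ∫ u in Ioc 0 √2, (1 - Φ u ^ n) / u ^ 2 ≤
      1 / 2 * ∑ k ∈ Finset.range n, wallisInt k := by
    rw [← (integral_Ioc_one_sub_pow_div_sq n).2]
    refine setIntegral_mono_on (hint.mono_set Ioc_subset_Ioi_self)
      (integral_Ioc_one_sub_pow_div_sq n).1 measurableSet_Ioc fun u hu => ?_
    have hu2 : u ^ 2 ≤ 2 := by
      rw [← Real.sq_sqrt (zero_le_two (α := ℝ))]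
      exact pow_le_pow_left₀ hu.1.le hu.2 2
    have := pow_le_pow_left₀ (by linarith : 0 ≤ 1 - u ^ 2 / 2) (h0 u) n
    gcongr
  have b2 : ∫ u in Ioc √2 u₁, (1 - Φ u ^ n) / u ^ 2 ≤ (1 + r₁ ^ n) * (1 / √2 - 1 / u₁) := by
    rw [← (setIntegral_Ioc_const_div_sq hs hu₁ _).2]
    refine setIntegral_mono_on (i1.mono_set Ioc_subset_Ioi_self)
      (setIntegral_Ioc_const_div_sq hs hu₁ _).1 measurableSet_Ioc fun u hu => ?_
    have := hpow hr₁ (hle u) (h1 u (hs.trans hu.1).le hu.2)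
    gcongr
    linarith
  have b3 : ∫ u in Ioc u₁ u₂, (1 - Φ u ^ n) / u ^ 2 ≤ (1 + r₂ ^ n) * (1 / u₁ - 1 / u₂) := by
    rw [← (setIntegral_Ioc_const_div_sq hu₁0 hu₂ _).2]
    refine setIntegral_mono_on (i2.mono_set Ioc_subset_Ioi_self)
      (setIntegral_Ioc_const_div_sq hu₁0 hu₂ _).1 measurableSet_Ioc fun u hu => ?_
    have := hpow hr₂ (hle u) (h2 u (hu₁0.trans hu.1).le hu.2)
    gcongr
    linarith
  have b4 : ∫ u in Ioi u₂, (1 - Φ u ^ n) / u ^ 2 ≤ 1 / u₂ + 1 / (u₂ * (n + 1)) := by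
    rw [← (setIntegral_Ioi_one_add_pow_div_sq hu₂0 n).2]
    refine setIntegral_mono_on i3 (setIntegral_Ioi_one_add_pow_div_sq hu₂0 n).1
      measurableSet_Ioi fun u hu => ?_
    have hu0 : 0 < u := hu₂0.trans hu
    have := hpow (by positivity) (hle u) (neg_le_of_abs_le (h3 u hu0))
    gcongr
    linarith
  -- In the three outer ranges the contributions of the summand 1 in the numerators telescope to
  -- 1/√2.
  have hsum := sum_wallisInt hn
  rw [hdecomp]
  nlinarith [hsum]

/-- The tangent parabola of the cosine at `t`, as an even function, lies below the cosine. -/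
lemma cos_tangent_parabola_le {t : ℝ} (ht : 0 < t) (htπ : t ≤ π) (y : ℝ) :
    cos t - sin t / (2 * t) * (y ^ 2 - t ^ 2) ≤ cos y := by
  have hst : 0 ≤ sin t := sin_nonneg_of_nonneg_of_le_pi ht.le htπ
  have hc : 0 ≤ sin t / (2 * t) := by positivity
  have hconc : ∀ {x z : ℝ}, 0 ≤ x → x ≤ z → 0 < z → z ≤ π → x * sin z ≤ z * sin x := by
    intro x z hx hxz hz hzπ
    have := strictConcaveOn_sin_Icc.concaveOn.2
      (show (0 : ℝ) ∈ Icc 0 π from ⟨le_rfl, pi_pos.le⟩) (show z ∈ Icc 0 π from ⟨hz.le, hzπ⟩)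
      (sub_nonneg.2 ((div_le_one hz).2 hxz)) (by positivity : 0 ≤ x / z) (by ring)
    simp only [smul_eq_mul, mul_zero, sin_zero, zero_add, div_mul_cancel₀ _ hz.ne'] at this
    rw [div_mul_eq_mul_div, div_le_iff₀ hz] at this
    linarith
  -- The sign of h' compares sin y / y with sin t / t. Concavity of the sine on [0, π] makes sin y /
  -- y decreasing there, so h falls up to t and rises up to π; beyond π the cosine is at least cos π
  -- and the quadratic term only grows.
  set h : ℝ → ℝ := fun y => cos y + sin t / (2 * t) * y ^ 2 with hh
  have hd : ∀ y, HasDerivAt h (-sin y + sin t / t * y) y := by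
    intro y
    have := (hasDerivAt_cos y).add ((hasDerivAt_pow 2 y).const_mul (sin t / (2 * t)))
    convert! this using 1
    push_cast; field_simp
  have hcont : Continuous h := by fun_prop
  have hanti : AntitoneOn h (Icc 0 t) := by
    refine antitoneOn_of_deriv_nonpos (convex_Icc _ _) hcont.continuousOn
      (fun x _ => (hd x).differentiableAt.differentiableWithinAt) fun x hx => ?_
    rw [interior_Icc] at hx
    rw [(hd x).deriv]
    have := hconc hx.1.le hx.2.le ht htπ
    rw [div_mul_eq_mul_div, neg_add_nonpos_iff, div_le_iff₀ ht]
    linarith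
  have hmono : MonotoneOn h (Icc t π) := by
    refine monotoneOn_of_deriv_nonneg (convex_Icc _ _) hcont.continuousOn
      (fun x _ => (hd x).differentiableAt.differentiableWithinAt) fun x hx => ?_
    rw [interior_Icc] at hx
    rw [(hd x).deriv]
    have := hconc ht.le hx.1.le (ht.trans hx.1) hx.2.le
    rw [div_mul_eq_mul_div, le_neg_add_iff_add_le, add_zero, le_div_iff₀ ht]
    linarith
  have hpos : ∀ y, 0 ≤ y → h t ≤ h y := by
    intro y hy
    rcases le_total y t with hyt | hyt
    · exact hanti ⟨hy, hyt⟩ ⟨ht.le, le_rfl⟩ hyt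
    rcases le_total y π with hyπ | hyπ
    · exact hmono ⟨le_rfl, htπ⟩ ⟨hyt, hyπ⟩ hyt
    · refine (hmono ⟨le_rfl, htπ⟩ ⟨htπ, le_rfl⟩ htπ).trans ?_
      simp only [hh, cos_pi]
      have : π ^ 2 ≤ y ^ 2 := pow_le_pow_left₀ pi_pos.le hyπ 2
      exact add_le_add (neg_one_le_cos y) (mul_le_mul_of_nonneg_left this hc)
  have := hpos |y| (abs_nonneg y)
  simp only [hh, cos_abs, sq_abs] at this
  linarith

/-- The average of the tangent parabola at t depends only on the second moment, which is u² here.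
The parabola decreases in y² and equals cos t at y = t. -/
lemma cos_le_charNorm {q : ℝ} (hq : 1 < q) {t u : ℝ} (hu : 0 ≤ u) (hut : u ≤ t) (ht : 0 < t)
    (htπ : t ≤ π) : cos t ≤ charNorm q u := by
  have hst : 0 ≤ sin t := sin_nonneg_of_nonneg_of_le_pi ht.le htπ
  have hc : 0 ≤ sin t / (2 * t) := by positivity
  have h := le_charNorm_of_le_cos hq (α := cos t + sin t / (2 * t) * t ^ 2)
    (β := sin t / (2 * t)) (u := u) fun y => by
      have := cos_tangent_parabola_le ht htπ y; linarith
  have h2 : u ^ 2 ≤ t ^ 2 := pow_le_pow_left₀ hu hut 2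
  have := mul_le_mul_of_nonneg_left h2 hc
  linarith

/-- A numerical criterion from cos t = -cos(π - t): second-order Taylor with remainder 5/96 · x⁴ at
x = π - t, and π between 3.1415 and 3.1416. -/
lemma neg_le_cos_of_pi_sub {t r : ℝ} (h0 : t ≤ π) (h1 : 3.1416 - t ≤ 1)
    (hr : 1 - (3.1415 - t) ^ 2 / 2 + (3.1416 - t) ^ 4 * (5 / 96) ≤ r) (ht : t ≤ 3.1415) :
    -r ≤ cos t := by
  have hp1 := pi_gt_d4
  have hp2 := pi_lt_d4
  have h := cos_bound (x := π - t) (by rw [abs_of_nonneg (by linarith)]; linarith)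
  rw [abs_of_nonneg (by linarith : 0 ≤ π - t), cos_pi_sub] at h
  have h2 := (abs_le.1 h).2
  have h3 : (π - t) ^ 4 ≤ (3.1416 - t) ^ 4 :=
    pow_le_pow_left₀ (by linarith) (by linarith) 4
  have h4 : (3.1415 - t) ^ 2 ≤ (π - t) ^ 2 := pow_le_pow_left₀ (by linarith) (by linarith) 2
  linarith

lemma integrableOn_one_sub_charNorm_pow {q : ℝ} (hq : 1 < q) (n : ℕ) :
    IntegrableOn (fun u => (1 - charNorm q u ^ n) / u ^ 2) (Ioi 0) := by
  have hq0 : 0 < q := by linarith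
  refine Integrable.mono' (g := fun u : ℝ => (n + 4) * (1 + u ^ 2)⁻¹)
    (integrable_inv_one_add_sq.const_mul _).integrableOn ?_ ?_
  · have := (continuous_charNorm hq0).measurable
    exact Measurable.aestronglyMeasurable (by fun_prop)
  · filter_upwards [ae_restrict_mem measurableSet_Ioi] with u hu
    have hu0 : (0 : ℝ) < u := hu
    have h1 := one_sub_charNorm_pow_le hq n u
    have h2 : |charNorm q u ^ n| ≤ 1 := by
      rw [abs_pow]; exact pow_le_one₀ (abs_nonneg _) (abs_charNorm_le_one hq0 _)
    rw [abs_le] at h2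
    rw [Real.norm_eq_abs, abs_of_nonneg (div_nonneg (by linarith [h2.2]) (sq_nonneg u)),
      div_le_iff₀ (by positivity), ← div_eq_mul_inv, div_mul_eq_mul_div, le_div_iff₀ (by positivity)]
    have hu2 := sq_pos_of_pos hu0
    have hn : (0 : ℝ) ≤ n := Nat.cast_nonneg n
    rcases le_total (u ^ 2) 1 with h | h
    · have h3 : (1 - charNorm q u ^ n) * (1 + u ^ 2) ≤ n * (u ^ 2 / 2) * 2 :=
        mul_le_mul h1 (by linarith) (by positivity) (by positivity)
      nlinarith
    · have h3 : (1 - charNorm q u ^ n) * (1 + u ^ 2) ≤ 2 * (2 * u ^ 2) :=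
        mul_le_mul (by linarith [h2.1]) (by linarith) (by positivity) (by positivity)
      nlinarith

/-- The sequence n rⁿ does not increase as soon as (n + 1) r ≤ n, and r ≤ 21/22 ensures this from n
= 21 on. -/
lemma mul_pow_le_of_ge {r : ℝ} (hr : 0 ≤ r) (hr1 : r * 22 ≤ 21) {n : ℕ} (hn : 21 ≤ n) :
    n * r ^ n ≤ 21 * r ^ 21 := by
  induction n, hn using Nat.le_induction with
  | base => norm_num
  | succ n hn ih =>
    refine le_trans ?_ ih
    have hn' : (21 : ℝ) ≤ n := by exact_mod_cast hn
    have : ((n + 1 : ℕ) : ℝ) * r ≤ n := by push_cast; nlinarith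
    calc ((n + 1 : ℕ) : ℝ) * r ^ (n + 1) = ((n + 1 : ℕ) : ℝ) * r * r ^ n := by ring
      _ ≤ n * r ^ n := mul_le_mul_of_nonneg_right this (by positivity)

lemma sqrt_mul_pow_le {r c : ℝ} (hr1 : r ^ 2 * 22 ≤ 21) (hc : 0 ≤ c)
    (h : 21 * (r ^ 2) ^ 21 ≤ c ^ 2) {n : ℕ} (hn : 21 ≤ n) : √n * r ^ n ≤ c := by
  refine le_of_sq_le_sq ?_ hc
  rw [mul_pow, Real.sq_sqrt (Nat.cast_nonneg n), ← pow_mul, mul_comm n 2, pow_mul]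
  exact (mul_pow_le_of_ge (sq_nonneg r) hr1 hn).trans h

/-- The bound on the Wallis integral leaves the factor √(n / (n - 1/4)), about 1 + 1/(8n); 13/100
slightly exceeds 1/8. -/
lemma mul_wallisInt_le {n : ℕ} (hn : 21 ≤ n) :
    n * wallisInt (n - 1) ≤ √n * √(π / 2) * (1 + (13 / 100) / n) := by
  have hn' : (21 : ℝ) ≤ n := by exact_mod_cast hn
  refine le_of_sq_le_sq ?_ (by positivity)
  have h := wallisInt_sq_mul_le (n - 1)
  rw [Nat.cast_sub (by omega), Nat.cast_one, show (n : ℝ) - 1 + 3 / 4 = n - 1 / 4 by ring] at h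
  have h1 : wallisInt (n - 1) ^ 2 ≤ π / 2 / (n - 1 / 4) := by
    rwa [le_div_iff₀ (by linarith)]
  rw [mul_pow, mul_pow, mul_pow, Real.sq_sqrt (by positivity), Real.sq_sqrt (by positivity)]
  have h2 : (n : ℝ) ≤ (n - 1 / 4) * (1 + (13 / 100) / n) ^ 2 := by
    have : (n - 1 / 4 : ℝ) * (1 + (13 / 100) / n) ^ 2 =
        ((n - 1 / 4) * (n + 13 / 100) ^ 2) / n ^ 2 := by field_simp
    rw [this, le_div_iff₀ (by positivity)]
    nlinarith
  calc (n : ℝ) ^ 2 * wallisInt (n - 1) ^ 2 ≤ n ^ 2 * (π / 2 / (n - 1 / 4)) := by gcongr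
    _ = n * (π / 2) * (n / (n - 1 / 4)) := by ring
    _ ≤ n * (π / 2) * (1 + (13 / 100) / n) ^ 2 := by
      gcongr
      rw [div_le_iff₀ (by linarith)]
      linarith

/-- The budget is 6/25 = 13/100 + 11/100: the first part pays for the Wallis term, the second for
the error terms from the cuts at 2.4 and 2.7. The last cut is also the decay constant, the point
where the bound 2.7/u becomes nontrivial. -/
lemma absMoment_le {q : ℝ} (hq : 1 < q) (hdecay : ∀ u, 0 < u → |charNorm q u| ≤ 2.7 / u)
    {n : ℕ} (hn : 21 ≤ n) :
    absMoment q n ≤ sdXi q * (√n * √(π / 2) * (1 + (6 / 25) / n)) := by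
  have hq0 : 0 < q := by linarith
  have hn' : (21 : ℝ) ≤ n := by exact_mod_cast hn
  have hp1 := pi_gt_d4
  rw [absMoment_eq hq]
  refine mul_le_mul_of_nonneg_left ?_ (sdXi_pos hq).le
  have hs2 : √2 ≤ 1.4143 := Real.sqrt_le_iff.2 ⟨by norm_num, by norm_num⟩
  have hs2' : 1.4142 ≤ √2 := Real.le_sqrt_of_sq_le (by norm_num)
  have hc1 : -0.745 ≤ cos 2.4 := neg_le_cos_of_pi_sub (by linarith) (by norm_num) (by norm_num)
    (by norm_num)
  have hc2 : -0.905 ≤ cos 2.7 := neg_le_cos_of_pi_sub (by linarith) (by norm_num) (by norm_num)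
    (by norm_num)
  have h := integral_one_sub_pow_div_sq_le (Φ := charNorm q) (n := n) (by omega)
    (u₁ := 2.4) (u₂ := 2.7) (r₁ := 0.745) (r₂ := 0.905)
    (integrableOn_one_sub_charNorm_pow hq n) (one_sub_sq_div_two_le_charNorm hq)
    (abs_charNorm_le_one hq0) (by linarith) (by norm_num) (by norm_num) (by norm_num)
    (fun u hu0 hu => hc1.trans (cos_le_charNorm hq hu0 hu (by norm_num) (by linarith)))
    (fun u hu0 hu => hc2.trans (cos_le_charNorm hq hu0 hu (by norm_num) (by linarith))) hdecay
  refine h.trans ?_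
  have hw := mul_wallisInt_le hn
  have hp : 1.253 ≤ √(π / 2) := Real.le_sqrt_of_sq_le (by norm_num; linarith)
  have hsn : 0 < √(n : ℝ) := Real.sqrt_pos.2 (by linarith)
  have hsn1 : 4.58 ≤ √(n : ℝ) := Real.le_sqrt_of_sq_le (by norm_num; linarith)
  have hsn2 : √(n : ℝ) * √n = n := Real.mul_self_sqrt (by linarith)
  have e1 : √(n : ℝ) * 0.745 ^ n ≤ 0.0096 :=
    sqrt_mul_pow_le (by norm_num) (by norm_num) (by norm_num) hn
  have e2 : √(n : ℝ) * 0.905 ^ n ≤ 0.57 :=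
    sqrt_mul_pow_le (by norm_num) (by norm_num) (by norm_num) hn
  have e3 : √(n : ℝ) * (1 / (2.7 * (n + 1))) ≤ 0.081 := by
    rw [mul_one_div, div_le_iff₀ (by positivity)]
    nlinarith
  have hinv : 1 / √2 ≤ 0.7072 := by
    rw [div_le_iff₀ (by positivity)]; nlinarith
  have herr : √(n : ℝ) * (0.745 ^ n * (1 / √2 - 1 / 2.4) + 0.905 ^ n * (1 / 2.4 - 1 / 2.7) +
      1 / (2.7 * (n + 1))) ≤ √(π / 2) * (11 / 100) := by
    have hp0 : (0 : ℝ) ≤ √(n : ℝ) * 0.745 ^ n := by positivity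
    have f1 : √(n : ℝ) * 0.745 ^ n * (1 / √2 - 1 / 2.4) ≤ 0.0096 * (0.7072 - 1 / 2.4) :=
      mul_le_mul e1 (by linarith) (sub_nonneg.2 (by
        rw [div_le_div_iff₀ (by norm_num) (by positivity)]; linarith)) (by norm_num)
    have f2 : √(n : ℝ) * 0.905 ^ n * (1 / 2.4 - 1 / 2.7) ≤ 0.57 * (1 / 2.4 - 1 / 2.7) :=
      mul_le_mul_of_nonneg_right e2 (by norm_num)
    have c1 : (0.0096 : ℝ) * (0.7072 - 1 / 2.4) + 0.57 * (1 / 2.4 - 1 / 2.7) + 0.081 ≤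
        1.253 * (11 / 100) := by norm_num
    rw [mul_add, mul_add, ← mul_assoc, ← mul_assoc]
    linarith
  have herr' : 0.745 ^ n * (1 / √2 - 1 / 2.4) + 0.905 ^ n * (1 / 2.4 - 1 / 2.7) +
      1 / (2.7 * (n + 1)) ≤ √n * √(π / 2) * ((11 / 100) / n) := by
    have : √(n : ℝ) * √(π / 2) * ((11 / 100) / n) = √(π / 2) * (11 / 100) / √n := by
      rw [eq_div_iff hsn.ne', show √(n : ℝ) * √(π / 2) * ((11 / 100) / n) * √n =
        √n * √n * (√(π / 2) * (11 / 100)) / n by ring, hsn2]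
      field_simp
    rw [this, le_div_iff₀ hsn, mul_comm]
    exact herr
  calc _ ≤ √n * √(π / 2) * (1 + (13 / 100) / n) + √n * √(π / 2) * ((11 / 100) / n) :=
        add_le_add hw herr'
    _ = _ := by ring

/-! ### Decay of the characteristic function -/

lemma integrable_integral_abs_deriv_of_unimodal {G G' : ℝ → ℝ} {m : ℝ} (hm : 0 < m)
    (hc : ContinuousOn G (Ici 0)) (hd : ∀ x ∈ Ioi (0 : ℝ), HasDerivAt G (G' x) x)
    (hpos : ∀ x ∈ Ioo 0 m, 0 ≤ G' x) (hneg : ∀ x ∈ Ioi m, G' x ≤ 0)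
    (h0 : G 0 = 0) (htop : Tendsto G atTop (𝓝 0)) :
    IntegrableOn G' (Ioi 0) ∧ ∫ x in Ioi 0, |G' x| = 2 * G m := by
  have hcm : ContinuousOn G (Icc 0 m) := hc.mono Icc_subset_Ici_self
  have i1 : IntegrableOn G' (Ioc 0 m) := intervalIntegral.integrableOn_deriv_of_nonneg hcm
    (fun x hx => hd x hx.1) hpos
  have hdm : ∀ x ∈ Ici m, HasDerivAt G (G' x) x := fun x hx => hd x (hm.trans_le hx)
  have i2 : IntegrableOn G' (Ioi m) := integrableOn_Ioi_deriv_of_nonpos' hdm hneg htop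
  have hu : Ioc 0 m ∪ Ioi m = Ioi 0 := Ioc_union_Ioi_eq_Ioi hm.le
  refine ⟨hu ▸ i1.union i2, ?_⟩
  rw [← hu, setIntegral_union (Ioc_disjoint_Ioi le_rfl) measurableSet_Ioi i1.abs i2.abs]
  have e1 : ∫ x in Ioc 0 m, |G' x| = G m := by
    have h1 : ∫ x in Ioc 0 m, |G' x| = ∫ x in Ioc 0 m, G' x := by
      rw [integral_Ioc_eq_integral_Ioo, integral_Ioc_eq_integral_Ioo]
      exact setIntegral_congr_fun measurableSet_Ioo fun x hx => abs_of_nonneg (hpos x hx)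
    rw [h1, ← intervalIntegral.integral_of_le hm.le,
      intervalIntegral.integral_eq_sub_of_hasDerivAt_of_le hm.le hcm (fun x hx => hd x hx.1)
        ((intervalIntegrable_iff_integrableOn_Ioc_of_le hm.le).2 i1), h0, sub_zero]
  have e2 : ∫ x in Ioi m, |G' x| = G m := by
    have h1 : ∫ x in Ioi m, |G' x| = ∫ x in Ioi m, -G' x :=
      setIntegral_congr_fun measurableSet_Ioi fun x hx => abs_of_nonpos (hneg x hx)
    rw [h1, integral_neg, integral_Ioi_of_hasDerivAt_of_nonpos' hdm hneg htop]
    ring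
  rw [e1, e2]; ring

/-- Split the left side as (y e^{-2y})^w · e^{-(1-2w)y}. The maximum of y e^{-2y} is 1/(2e), at y =
1/2, and the second factor is at most 1 because w ≤ 1/2. -/
lemma rpow_mul_exp_neg_le {y w : ℝ} (hy : 0 ≤ y) (hw0 : 0 ≤ w) (hw : w ≤ 1 / 2) :
    y ^ w * exp (-y) ≤ (1 / (2 * exp 1)) ^ w := by
  have h1 : y * exp (-(2 * y)) ≤ 1 / (2 * exp 1) := by
    rw [le_div_iff₀ (by positivity)]
    have h2 := add_one_le_exp (2 * y - 1)
    have h3 : exp (-(2 * y)) * exp 1 * exp (2 * y - 1) = 1 := by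
      rw [← exp_add, ← exp_add]; ring_nf; exact exp_zero
    have h4 : 0 < exp (-(2 * y)) * exp 1 := by positivity
    nlinarith
  have h2 : y ^ w * exp (-y) = (y * exp (-(2 * y))) ^ w * exp (-(y * (1 - 2 * w))) := by
    rw [Real.mul_rpow hy (exp_pos _).le, ← exp_mul, mul_assoc, ← exp_add]
    ring_nf
  rw [h2]
  have h3 : exp (-(y * (1 - 2 * w))) ≤ 1 := exp_le_one_iff.2 (by nlinarith)
  calc _ ≤ (1 / (2 * exp 1)) ^ w * 1 := by gcongr
    _ = _ := mul_one _

/-- Integration by parts: e^{-x^q} cos(t x^(q-1)) is the derivative of sin(t x^(q-1)) times G(x) /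
(t (q-1)), where G = x^(2-q) e^{-x^q}. Since q < 2 the boundary terms vanish, and what remains is
bounded by the total variation of G, twice its maximum. -/
lemma abs_charXi_le_div {q t : ℝ} (hq1 : 4 / 3 < q) (hq2 : q < 2) (ht : 0 < t) :
    |charXi q t| ≤ 2 * (1 / (2 * exp 1)) ^ (2 / q - 1) / ((q - 1) * Gamma (1 / q + 1)) / t := by
  have hq0 : 0 < q := by linarith
  have hV := lqMass_pos hq0
  set G : ℝ → ℝ := fun x => x ^ (2 - q) * exp (-x ^ q) with hG
  set G' : ℝ → ℝ := fun x => x ^ (1 - q) * ((2 - q) - q * x ^ q) * exp (-x ^ q) with hG'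
  -- The critical point of G, where q x^q = 2 - q.
  set m : ℝ := ((2 - q) / q) ^ (1 / q) with hm
  have hm0 : 0 < m := Real.rpow_pos_of_pos (div_pos (by linarith) hq0) _
  have hmq : q * m ^ q = 2 - q := by
    rw [hm, ← Real.rpow_mul (div_pos (by linarith) hq0).le, one_div_mul_cancel hq0.ne',
      Real.rpow_one]
    field_simp
  have hGc : Continuous G := by
    have h1 : Continuous fun x : ℝ => x ^ (2 - q) :=
      Real.continuous_rpow_const (by linarith)
    have h2 : Continuous fun x : ℝ => x ^ q := Real.continuous_rpow_const hq0.le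
    fun_prop
  have hGd : ∀ x ∈ Ioi (0 : ℝ), HasDerivAt G (G' x) x := by
    intro x hx
    have hx0 : (0 : ℝ) < x := hx
    have h1 := Real.hasDerivAt_rpow_const (x := x) (p := 2 - q) (Or.inl hx0.ne')
    have h2 := (Real.hasDerivAt_rpow_const (x := x) (p := q) (Or.inl hx0.ne')).fun_neg.exp
    convert! h1.mul h2 using 1
    have e1 : x ^ (2 - q - 1) = x ^ (1 - q) := by congr 1; ring
    have e2 : x ^ (2 - q) * x ^ (q - 1) = x := by
      rw [← Real.rpow_add hx0]; ring_nf; exact Real.rpow_one x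
    have e3 : x ^ (1 - q) * x ^ q = x := by
      rw [← Real.rpow_add hx0]; ring_nf; exact Real.rpow_one x
    simp only [hG', e1]
    linear_combination (-q * exp (-x ^ q)) * e3 + (q * exp (-x ^ q)) * e2
  have hG0 : G 0 = 0 := by
    simp only [hG]; rw [Real.zero_rpow (by linarith), zero_mul]
  have hGle : ∀ x, 0 ≤ x → G x ≤ (1 / (2 * exp 1)) ^ (2 / q - 1) := by
    intro x hx
    -- In the variable y = x^q the function G is y^w e^{-y} with w = 2/q - 1, and q > 4/3 is what
    -- puts w below 1/2.
    have h := rpow_mul_exp_neg_le (y := x ^ q) (w := 2 / q - 1) (by positivity)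
      (by rw [sub_nonneg, le_div_iff₀ hq0]; linarith)
      (by rw [sub_le_iff_le_add, div_le_iff₀ hq0]; linarith)
    rwa [← Real.rpow_mul hx, show q * (2 / q - 1) = 2 - q by field_simp] at h
  have hGtop : Tendsto G atTop (𝓝 0) := by
    have h1 := (tendsto_rpow_mul_exp_neg_mul_atTop_nhds_zero ((2 - q) / q) 1 one_pos).comp
      (tendsto_rpow_atTop hq0)
    refine h1.congr' ?_
    filter_upwards [eventually_ge_atTop 0] with x hx
    simp only [Function.comp_apply, hG]
    rw [← Real.rpow_mul hx, mul_div_cancel₀ _ hq0.ne', neg_one_mul]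
  obtain ⟨hint, hval⟩ := integrable_integral_abs_deriv_of_unimodal hm0 hGc.continuousOn hGd
    (fun x hx => by
      have : x ^ q ≤ m ^ q := Real.rpow_le_rpow hx.1.le hx.2.le hq0.le
      have h2 : 0 ≤ (2 - q) - q * x ^ q := by nlinarith
      have := Real.rpow_nonneg hx.1.le (1 - q)
      simp only [hG']; positivity)
    (fun x hx => by
      have hx' : m < x := hx
      have hx0 : 0 < x := hm0.trans hx'
      have : m ^ q ≤ x ^ q := Real.rpow_le_rpow hm0.le hx'.le hq0.le
      have h2 : (2 - q) - q * x ^ q ≤ 0 := by nlinarith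
      exact mul_nonpos_of_nonpos_of_nonneg
        (mul_nonpos_of_nonneg_of_nonpos (Real.rpow_nonneg hx0.le _) h2) (exp_pos _).le)
    hG0 hGtop
  set A : ℝ → ℝ := fun x => exp (-x ^ q) * cos (t * x ^ (q - 1))
  set B : ℝ → ℝ := fun x => sin (t * x ^ (q - 1)) * G' x
  have hAint : IntegrableOn A (Ioi 0) := by
    have h1 : IntegrableOn (fun x : ℝ => exp (-x ^ q)) (Ioi 0) :=
      Integrable.of_integral_ne_zero (by
        rw [integral_exp_neg_rpow hq0]; exact (Gamma_pos_of_pos (by positivity)).ne')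
    refine h1.mul_bdd (c := 1) (Measurable.aestronglyMeasurable (by fun_prop))
      (Eventually.of_forall fun x => by simpa using abs_cos_le_one _)
  have hBint : IntegrableOn B (Ioi 0) :=
    hint.bdd_mul (c := 1) (Measurable.aestronglyMeasurable (by fun_prop))
      (Eventually.of_forall fun x => by simpa using abs_sin_le_one _)
  have hPd : ∀ x ∈ Ioi (0 : ℝ), HasDerivAt (fun x => sin (t * x ^ (q - 1)) * G x)
      (t * (q - 1) * A x + B x) x := by
    intro x hx
    have hx0 : (0 : ℝ) < x := hx
    have h1 := ((Real.hasDerivAt_rpow_const (x := x) (p := q - 1)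
      (Or.inl hx0.ne')).const_mul t).sin
    convert! h1.mul (hGd x hx) using 1
    have e2 : x ^ (q - 1 - 1) * x ^ (2 - q) = 1 := by
      rw [← Real.rpow_add hx0]; ring_nf; exact Real.rpow_zero x
    simp only [A, B, hG]
    linear_combination (-(t * (q - 1) * exp (-x ^ q) * cos (t * x ^ (q - 1)))) * e2
  have hPc : Continuous fun x => sin (t * x ^ (q - 1)) * G x := by
    have h1 : Continuous fun x : ℝ => x ^ (q - 1) := Real.continuous_rpow_const (by linarith)
    fun_prop
  have hPtop : Tendsto (fun x => sin (t * x ^ (q - 1)) * G x) atTop (𝓝 0) := by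
    have h1 := hGtop.norm
    rw [norm_zero] at h1
    refine squeeze_zero_norm (fun x => ?_) h1
    rw [norm_mul]
    exact mul_le_of_le_one_left (norm_nonneg _) (by simpa using abs_sin_le_one _)
  have hfin := integral_Ioi_of_hasDerivAt_of_tendsto hPc.continuousWithinAt hPd
    ((hAint.const_mul _).add hBint) hPtop
  rw [integral_add (hAint.const_mul _) hBint, integral_const_mul, hG0, mul_zero, sub_zero] at hfin
  have hB : |∫ x in Ioi 0, B x| ≤ 2 * (1 / (2 * exp 1)) ^ (2 / q - 1) := by
    have h1 : |∫ x in Ioi 0, B x| ≤ ∫ x in Ioi 0, |G' x| := by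
      rw [← Real.norm_eq_abs (∫ x in Ioi 0, B x)]
      refine norm_integral_le_of_norm_le (f := B) hint.abs (Eventually.of_forall fun x => ?_)
      simp only [B]
      rw [Real.norm_eq_abs, abs_mul]
      exact mul_le_of_le_one_left (abs_nonneg _) (abs_sin_le_one _)
    rw [hval] at h1
    linarith [hGle m hm0.le]
  have hchar : charXi q t = 2 / lqMass q * ∫ x in Ioi 0, A x := by
    rw [charXi, integral_lqMeasure hq0]
    have h1 : ∀ x : ℝ, exp (-|x| ^ q) • cos (t * xi q x) = A |x| := by
      intro x
      simp only [A, smul_eq_mul]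
      rw [← abs_xi (by linarith), ← cos_abs (t * |xi q x|), ← cos_abs (t * xi q x), abs_mul,
        abs_mul, abs_abs]
    simp only [h1]
    rw [integral_comp_abs, smul_eq_mul]
    ring
  have hAabs : t * (q - 1) * |∫ x in Ioi 0, A x| ≤ 2 * (1 / (2 * exp 1)) ^ (2 / q - 1) := by
    have h1 : t * (q - 1) * ∫ x in Ioi 0, A x = -∫ x in Ioi 0, B x := by linarith
    have h2 : 0 ≤ t * (q - 1) := mul_nonneg ht.le (by linarith)
    rw [← abs_of_nonneg h2, ← abs_mul, h1, abs_neg]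
    exact hB
  have hΓ : 0 < Gamma (1 / q + 1) := Gamma_pos_of_pos (by positivity)
  have hq3 : 0 < q - 1 := by linarith
  rw [hchar, abs_mul, abs_of_pos (by positivity), lqMass, div_div, le_div_iff₀ (by positivity)]
  calc _ = t * (q - 1) * |∫ x in Ioi 0, A x| := by field_simp
    _ ≤ _ := hAabs

/-! ### Numerical estimates for the decay constant -/

lemma cos_le_quartic {x : ℝ} (hx : 0 ≤ x) : cos x ≤ 1 - x ^ 2 / 2 + x ^ 4 / 24 := by
  have hd : ∀ x, HasDerivAt (fun x : ℝ => 1 - x ^ 2 / 2 + x ^ 4 / 24 - cos x)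
      (-x + x ^ 3 / 6 + sin x) x := by
    intro x
    have := ((((hasDerivAt_pow 2 x).div_const 2).const_sub 1).add
      ((hasDerivAt_pow 4 x).div_const 24)).sub (hasDerivAt_cos x)
    convert! this using 1
    push_cast; ring
  have hmono : MonotoneOn (fun x : ℝ => 1 - x ^ 2 / 2 + x ^ 4 / 24 - cos x) (Ici 0) := by
    refine monotoneOn_of_deriv_nonneg (convex_Ici 0) (by fun_prop)
      (fun x _ => (hd x).differentiableAt.differentiableWithinAt) fun x hx => ?_
    rw [interior_Ici] at hx
    rw [(hd x).deriv]
    have := (abs_le.1 (abs_sub_sin_le x)).2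
    rw [abs_of_pos hx] at this
    linarith
  have := hmono self_mem_Ici hx hx
  simp at this
  linarith

lemma sin_le_quintic {x : ℝ} (hx : 0 ≤ x) : sin x ≤ x - x ^ 3 / 6 + x ^ 5 / 120 := by
  have hd : ∀ x, HasDerivAt (fun x : ℝ => x - x ^ 3 / 6 + x ^ 5 / 120 - sin x)
      (1 - x ^ 2 / 2 + x ^ 4 / 24 - cos x) x := by
    intro x
    have := (((hasDerivAt_id x).sub ((hasDerivAt_pow 3 x).div_const 6)).add
      ((hasDerivAt_pow 5 x).div_const 120)).sub (hasDerivAt_sin x)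
    convert! this using 1
    push_cast; ring
  have hmono : MonotoneOn (fun x : ℝ => x - x ^ 3 / 6 + x ^ 5 / 120 - sin x) (Ici 0) := by
    refine monotoneOn_of_deriv_nonneg (convex_Ici 0) (by fun_prop)
      (fun x _ => (hd x).differentiableAt.differentiableWithinAt) fun x hx => ?_
    rw [interior_Ici] at hx
    rw [(hd x).deriv]
    have := cos_le_quartic (le_of_lt hx : (0 : ℝ) ≤ x)
    linarith
  have := hmono self_mem_Ici hx hx
  simp at this
  linarith

/-- For x > 0 this is 1/sin² x ≥ 1/x² + 1/3. It serves both to bound sin x / x in the decay constant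
and to prove the concavity behind `le_logGap`. -/
lemma sin_sq_mul_le {x : ℝ} (hx0 : 0 ≤ x) (hx : x ≤ π / 2) :
    sin x ^ 2 * (3 + x ^ 2) ≤ 3 * x ^ 2 := by
  have h1 := sin_le_quintic hx0
  have h2 : 0 ≤ sin x := sin_nonneg_of_nonneg_of_le_pi hx0 (by linarith [pi_pos])
  have h3 : x ≤ 1.5708 := by linarith [pi_lt_d4]
  have h4 : sin x ^ 2 ≤ (x - x ^ 3 / 6 + x ^ 5 / 120) ^ 2 := pow_le_pow_left₀ h2 h1 2
  have h5 : (1 - x ^ 2 / 6 + x ^ 4 / 120) ^ 2 * (3 + x ^ 2) ≤ 3 := by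
    set z := x ^ 2 with hz
    have hz0 : 0 ≤ z := sq_nonneg x
    have hz1 : z ≤ 2.5 := by nlinarith
    have : x ^ 4 = z ^ 2 := by rw [hz]; ring
    rw [this]
    -- This expression is exactly 3 minus the left side of the goal, expanded in z.
    have h6 : 0 ≤ z ^ 2 * (1 / 5 - 13 / 360 * z + z ^ 2 * (37 - z) / 14400) := by
      have : 0 ≤ z ^ 2 * (37 - z) := mul_nonneg (sq_nonneg z) (by linarith)
      exact mul_nonneg (sq_nonneg z) (by linarith)
    nlinarith [h6]
  calc sin x ^ 2 * (3 + x ^ 2) ≤ (x - x ^ 3 / 6 + x ^ 5 / 120) ^ 2 * (3 + x ^ 2) := by gcongr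
    _ = x ^ 2 * ((1 - x ^ 2 / 6 + x ^ 4 / 120) ^ 2 * (3 + x ^ 2)) := by ring
    _ ≤ x ^ 2 * 3 := by gcongr
    _ = _ := by ring

/-- Log-convexity at 9/4, the midpoint of 2 and 5/2 where Γ is known, followed by one step of the
functional equation. -/
lemma Gamma_five_div_four_le : Gamma (5 / 4) ≤ 0.923 := by
  have hp := pi_lt_d4
  have h1 : Gamma (9 / 4) = 5 / 4 * Gamma (5 / 4) := by
    rw [show (9 / 4 : ℝ) = 5 / 4 + 1 by norm_num, Gamma_add_one (by norm_num)]
  have h2 : Gamma (5 / 2) = 3 / 4 * √π := by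
    rw [show (5 / 2 : ℝ) = 1 / 2 + 1 + 1 by norm_num, Gamma_add_one (by norm_num),
      Gamma_add_one (by norm_num), Gamma_one_half_eq]
    ring
  have h := Gamma_mul_add_mul_le_rpow_Gamma_mul_rpow_Gamma (s := 2) (t := 5 / 2) (a := 1 / 2)
    (b := 1 / 2) (by norm_num) (by norm_num) (by norm_num) (by norm_num) (by norm_num)
  rw [show (1 / 2 * 2 + 1 / 2 * (5 / 2) : ℝ) = 9 / 4 by norm_num, h1, h2, Gamma_two,
    Real.one_rpow, one_mul, ← Real.sqrt_eq_rpow] at h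
  have h3 : √π ≤ 1.7725 := Real.sqrt_le_iff.2 ⟨by norm_num, by norm_num; linarith⟩
  have h4 : √(3 / 4 * √π) ≤ 1.1531 := Real.sqrt_le_iff.2 ⟨by norm_num, by norm_num; linarith⟩
  linarith

lemma Gamma_le_of_mem_Icc {x : ℝ} (h1 : 5 / 4 ≤ x) (h2 : x ≤ 3 / 2) : Gamma x ≤ 0.923 := by
  have h3 : Gamma (3 / 2) ≤ 0.923 := by
    rw [show (3 / 2 : ℝ) = 1 / 2 + 1 by norm_num, Gamma_add_one (by norm_num), Gamma_one_half_eq]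
    have := pi_lt_d4
    have : √π ≤ 1.7725 := Real.sqrt_le_iff.2 ⟨by norm_num, by norm_num; linarith⟩
    linarith
  have := convexOn_Gamma.le_max_of_mem_Icc (x := 5 / 4) (y := 3 / 2) (by norm_num) (by norm_num)
    ⟨h1, h2⟩
  exact this.trans (max_le Gamma_five_div_four_le h3)

lemma ConvexOn.le_linear_of_endpoints {f : ℝ → ℝ} (hf : ConvexOn ℝ univ f) {a b c d x : ℝ}
    (hax : a ≤ x) (hxb : x ≤ b) (ha : f a ≤ c + d * a) (hb : f b ≤ c + d * b) :
    f x ≤ c + d * x := by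
  have hg : ConvexOn ℝ univ fun x => f x - (c + d * x) := by
    refine hf.sub ⟨convex_univ, fun x _ y _ s t _ _ hst => ?_⟩
    simp only [smul_eq_mul]
    have : c = (s + t) * c := by rw [hst, one_mul]
    nlinarith
  have := hg.le_max_of_mem_Icc (mem_univ a) (mem_univ b) ⟨hax, hxb⟩
  have h2 := this.trans (max_le (sub_nonpos.2 ha) (sub_nonpos.2 hb))
  linarith

/-- Linear majorants of `(2e)^(-w)` on `[0, 1/2]`. -/
lemma rpow_two_mul_exp_le_linear {w : ℝ} :
    (1 / 5 ≤ w → w ≤ 1 / 2 → (1 / (2 * exp 1)) ^ w ≤ 9 / 10 * (1 - w)) ∧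
    (0 ≤ w → w ≤ 1 / 5 → (1 / (2 * exp 1)) ^ w ≤ 1 - w) := by
  have he := exp_one_gt_d9
  set b : ℝ := 1 / (2 * exp 1)
  have hb0 : 0 < b := by positivity
  have hb : b ≤ 0.184 := by
    simp only [b]
    rw [div_le_iff₀ (by positivity)]; linarith
  have hconv := convexOn_rpow_left (b := b) hb0
  -- By convexity only the end points matter; 0.72 and 0.45 are the values of 9/10 · (1 - w) at w =
  -- 1/5 and w = 1/2.
  have h5 : b ^ (1 / 5 : ℝ) ≤ 0.72 := by
    refine le_of_pow_le_pow_left₀ (n := 5) (by norm_num) (by norm_num) ?_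
    rw [← Real.rpow_natCast, ← Real.rpow_mul hb0.le]
    norm_num
    linarith
  have h2 : b ^ (1 / 2 : ℝ) ≤ 0.45 := by
    rw [← Real.sqrt_eq_rpow]
    exact Real.sqrt_le_iff.2 ⟨by norm_num, by norm_num; linarith⟩
  constructor
  · intro h1 h3
    have := ConvexOn.le_linear_of_endpoints hconv (c := 9 / 10) (d := -9 / 10) h1 h3
      (h5.trans (by norm_num)) (h2.trans (by norm_num))
    linarith
  · intro h1 h3
    have := ConvexOn.le_linear_of_endpoints hconv (c := 1) (d := -1) h1 h3
      (by simp) (h5.trans (by norm_num))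
    linarith

lemma sin_le_mul_of_sq_le {x c l : ℝ} (hx0 : 0 < x) (hx : x ≤ π / 2) (hl : 0 ≤ l) (hlx : l ≤ x)
    (hc : 0 ≤ c) (h : 3 ≤ c ^ 2 * (3 + l ^ 2)) : sin x ≤ c * x := by
  have h1 := sin_sq_mul_le hx0.le hx
  refine le_of_sq_le_sq ?_ (by positivity)
  have h2 : l ^ 2 ≤ x ^ 2 := pow_le_pow_left₀ hl hlx 2
  have h3 : 3 ≤ c ^ 2 * (3 + x ^ 2) := h.trans (by gcongr)
  have h4 : sin x ^ 2 * (3 + x ^ 2) ≤ (c * x) ^ 2 * (3 + x ^ 2) := by nlinarith [sq_nonneg x]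
  exact le_of_mul_le_mul_right h4 (by positivity)

/-- With s = 1/q, v = 1 - s and S = sin(πv)/(πv), the reflection formula reads Γ(s) Γ(2-s) S = 1. It
eliminates Γ(s), and the square of the constant becomes 4 (b/v)² Γ(2-s)⁴ S³, whose factors are
bounded separately. -/
lemma charNorm_decay_const_le {q : ℝ} (hq1 : 4 / 3 < q) (hq2 : q < 2) :
    sdXi q * (2 * (1 / (2 * exp 1)) ^ (2 / q - 1) / ((q - 1) * Gamma (1 / q + 1))) ≤ 2.7 := by
  have hq0 : 0 < q := by linarith
  set s := 1 / q with hs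
  have hs1 : 1 / 2 < s := by rw [hs, lt_div_iff₀ hq0]; linarith
  have hs2 : s < 3 / 4 := by rw [hs, div_lt_iff₀ hq0]; linarith
  have hqs : q = 1 / s := by rw [hs, one_div_one_div]
  set v := 1 - s with hv
  set b := (1 / (2 * exp 1)) ^ (2 / q - 1) with hb
  have hb0 : 0 < b := by positivity
  have hw : 2 / q - 1 = 1 - 2 * v := by rw [hv, hs]; ring
  have hΓs : 0 < Gamma s := Gamma_pos_of_pos (by linarith)
  have hΓ2 : 0 < Gamma (2 - s) := Gamma_pos_of_pos (by linarith)
  have hΓle : Gamma (2 - s) ≤ 0.923 := Gamma_le_of_mem_Icc (by linarith) (by linarith)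
  have hv0 : 0 < v := by linarith
  have hsin : 0 < sin (π * v) := sin_pos_of_pos_of_lt_pi (by positivity)
    (by nlinarith [pi_pos])
  have hrefl : Gamma s * Gamma (2 - s) * sin (π * v) = π * v := by
    have h1 := Gamma_mul_Gamma_one_sub s
    have h2 : sin (π * s) = sin (π * v) := by
      rw [hv, mul_sub, mul_one, sin_pi_sub]
    have h3 : Gamma (2 - s) = v * Gamma v := by
      rw [show 2 - s = v + 1 by rw [hv]; ring, Gamma_add_one hv0.ne']
    rw [h2, eq_div_iff hsin.ne'] at h1
    rw [h3]
    linear_combination v * h1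
  have hrewrite : sdXi q * (2 * b / ((q - 1) * Gamma (s + 1))) =
      √(Gamma (2 - s) / Gamma s) * (2 * b / (v * Gamma s)) := by
    rw [sdXi, Gamma_add_one (by linarith), hqs, one_div_one_div]
    have : (1 / s - 1) * (s * Gamma s) = v * Gamma s := by
      rw [hv]; field_simp
    rw [this]
  rw [hrewrite]
  refine le_of_sq_le_sq ?_ (by norm_num)
  rw [mul_pow, Real.sq_sqrt (by positivity)]
  have hpv : 0 < π * v := by positivity
  obtain ⟨S, hS⟩ : ∃ S, S = sin (π * v) / (π * v) := ⟨_, rfl⟩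
  have hS0 : 0 < S := by rw [hS]; positivity
  have hΓS : Gamma s = 1 / (Gamma (2 - s) * S) := by
    rw [hS, eq_div_iff (by positivity), ← mul_assoc, mul_div_assoc', hrefl, div_self hpv.ne']
  have hform : Gamma (2 - s) / Gamma s * (2 * b / (v * Gamma s)) ^ 2 =
      4 * (b / v) ^ 2 * Gamma (2 - s) ^ 4 * S ^ 3 := by
    rw [hΓS]; field_simp; ring
  rw [hform]
  have key : ∀ E c : ℝ, b / v ≤ E → S ≤ c → 4 * E ^ 2 * 0.923 ^ 4 * c ^ 3 ≤ 2.7 ^ 2 →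
      4 * (b / v) ^ 2 * Gamma (2 - s) ^ 4 * S ^ 3 ≤ 2.7 ^ 2 := by
    intro E c h1 h2 h3
    refine le_trans ?_ h3
    have : 0 < b / v := by positivity
    gcongr
  have hp := pi_gt_d4
  -- The break v = 2/5 corresponds to w = 1 - 2v = 1/5, where the linear majorant of b changes. The
  -- values 0.785 and 1.256 lie just below π/4 and 2π/5, the least values of πv in the two cases.
  rcases le_total v (2 / 5) with h | h
  · refine key 1.8 0.911 ?_ ?_ (by norm_num)
    · rw [div_le_iff₀ hv0, hb, hw]
      have := rpow_two_mul_exp_le_linear.1 (by linarith : 1 / 5 ≤ 1 - 2 * v) (by linarith)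
      linarith
    · rw [hS, div_le_iff₀ hpv]
      exact sin_le_mul_of_sq_le (l := 0.785) hpv (by nlinarith) (by norm_num) (by nlinarith)
        (by norm_num) (by norm_num)
  · refine key 2 0.81 ?_ ?_ (by norm_num)
    · rw [div_le_iff₀ hv0, hb, hw]
      have := rpow_two_mul_exp_le_linear.2 (by linarith : 0 ≤ 1 - 2 * v) (by linarith)
      linarith
    · rw [hS, div_le_iff₀ hpv]
      exact sin_le_mul_of_sq_le (l := 1.256) hpv (by nlinarith) (by norm_num) (by nlinarith)
        (by norm_num) (by norm_num)

lemma abs_charNorm_le_div {q u : ℝ} (hq1 : 4 / 3 < q) (hq2 : q < 2) (hu : 0 < u) :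
    |charNorm q u| ≤ 2.7 / u := by
  have hσ := sdXi_pos (by linarith : 1 < q)
  refine (abs_charXi_le_div hq1 hq2 (div_pos hu hσ)).trans ?_
  rw [div_div_eq_mul_div, mul_comm]
  gcongr
  exact charNorm_decay_const_le hq1 hq2

/-! ### The logarithmic gap and the threshold for n -/

/-- The gap between the logarithms in the comparison of the two directions, as a function of
`s = 1/q`. -/
def logGap (s : ℝ) : ℝ := log (sin (π * s)) - log (1 - s) - s * log 4

/-- The difference H of the two sides vanishes at 1/2 and 3/4, and it is concave: H'' ≤ 0 is
`sin_sq_mul_le` at x = π(1 - s). Hence H ≥ 0 in between. -/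
lemma le_logGap {s : ℝ} (h1 : 1 / 2 ≤ s) (h2 : s ≤ 3 / 4) :
    π ^ 2 / 6 * ((3 / 4 - s) * (s - 1 / 2)) ≤ logGap s := by
  set H : ℝ → ℝ := fun s => logGap s - π ^ 2 / 6 * ((3 / 4 - s) * (s - 1 / 2)) with hH
  set H' : ℝ → ℝ := fun s => π * cos (π * s) / sin (π * s) + 1 / (1 - s) - log 4 -
    π ^ 2 / 6 * (5 / 4 - 2 * s) with hH'
  set H'' : ℝ → ℝ := fun s => -π ^ 2 / sin (π * s) ^ 2 + 1 / (1 - s) ^ 2 + π ^ 2 / 3 with hH''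
  have hsin : ∀ s ∈ Icc (1 / 2 : ℝ) (3 / 4), 0 < sin (π * s) := fun s hs =>
    sin_pos_of_pos_of_lt_pi (mul_pos pi_pos (by linarith [hs.1])) (by nlinarith [pi_pos, hs.2])
  have hlin : ∀ s : ℝ, HasDerivAt (fun s : ℝ => π * s) π s := fun s => by
    simpa using (hasDerivAt_id s).const_mul π
  have hd1 : ∀ s ∈ Icc (1 / 2 : ℝ) (3 / 4), HasDerivAt H (H' s) s := by
    intro s hs
    have e1 := ((hlin s).sin).log (hsin s hs).ne'
    have e2 := ((hasDerivAt_id s).const_sub 1).log (by simp only [id]; linarith [hs.2])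
    have e3 := (hasDerivAt_id s).mul_const (log 4)
    have e4 := (((hasDerivAt_id s).const_sub (3 / 4)).mul
      ((hasDerivAt_id s).sub_const (1 / 2))).const_mul (π ^ 2 / 6)
    convert! ((e1.sub e2).sub e3).sub e4 using 1
    simp only [hH', id]
    ring
  have hd2 : ∀ s ∈ Icc (1 / 2 : ℝ) (3 / 4), HasDerivAt H' (H'' s) s := by
    intro s hs
    have hs0 := (hsin s hs).ne'
    have h10 : 1 - s ≠ 0 := by linarith [hs.2]
    have e1 := (((hlin s).cos).const_mul π).div (hlin s).sin hs0
    have e2 := (hasDerivAt_const s (1 : ℝ)).div ((hasDerivAt_id s).const_sub 1) h10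
    have e3 := ((((hasDerivAt_id s).const_mul 2).const_sub (5 / 4))).const_mul (π ^ 2 / 6)
    convert! ((e1.add e2).sub_const (log 4)).sub e3 using 1
    simp only [hH'', id]
    have := sin_sq_add_cos_sq (π * s)
    have h3 : (π * (-sin (π * s) * π) * sin (π * s) - π * cos (π * s) * (cos (π * s) * π)) =
        -π ^ 2 := by linear_combination (-π ^ 2) * this
    rw [h3]
    ring
  have hneg : ∀ s ∈ Icc (1 / 2 : ℝ) (3 / 4), H'' s ≤ 0 := by
    intro s hs
    have hx : 0 < π * (1 - s) := mul_pos pi_pos (by linarith [hs.2])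
    have h := sin_sq_mul_le hx.le (by nlinarith [pi_pos, hs.1])
    have hsx : sin (π * (1 - s)) = sin (π * s) := by rw [mul_sub, mul_one, sin_pi_sub]
    rw [hsx] at h
    have hp := hsin s hs
    have h10 : 0 < 1 - s := by linarith [hs.2]
    have h3 : H'' s = π ^ 2 * (sin (π * s) ^ 2 * (3 + (π * (1 - s)) ^ 2) -
        3 * (π * (1 - s)) ^ 2) / (3 * sin (π * s) ^ 2 * (π * (1 - s)) ^ 2) := by
      simp only [hH'']
      field_simp
      ring
    rw [h3]
    refine div_nonpos_of_nonpos_of_nonneg ?_ (by positivity)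
    exact mul_nonpos_of_nonneg_of_nonpos (sq_nonneg π) (by linarith)
  have hconc : ConcaveOn ℝ (Icc (1 / 2) (3 / 4)) H :=
    concaveOn_of_hasDerivWithinAt2_nonpos (convex_Icc _ _)
      (fun s hs => (hd1 s hs).continuousAt.continuousWithinAt)
      (fun s hs => (hd1 s (interior_subset hs)).hasDerivWithinAt)
      (fun s hs => (hd2 s (interior_subset hs)).hasDerivWithinAt)
      (fun s hs => hneg s (interior_subset hs))
  have hlog4 : log 4 = 2 * log 2 := by
    rw [show (4 : ℝ) = 2 ^ 2 by norm_num, log_pow]; norm_num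
  have hl : H (1 / 2) = 0 := by
    simp only [hH, logGap]
    rw [mul_one_div, sin_pi_div_two, show (1 : ℝ) - 1 / 2 = 2⁻¹ by norm_num, log_inv, log_one, hlog4]
    ring
  have hr : H (3 / 4) = 0 := by
    simp only [hH, logGap]
    have : sin (π * (3 / 4)) = √2 / 2 := by
      rw [show π * (3 / 4) = π - π / 4 by ring, sin_pi_sub, sin_pi_div_four]
    rw [this, log_div (by positivity) (by norm_num), log_sqrt (by norm_num),
      show (1 : ℝ) - 3 / 4 = 4⁻¹ by norm_num, log_inv, hlog4]
    ring
  have := hconc.min_le_of_mem_Icc (left_mem_Icc.2 (by norm_num)) (right_mem_Icc.2 (by norm_num))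
    ⟨h1, h2⟩
  rw [hl, hr, min_self] at this
  simp only [hH] at this
  linarith

/-- The limiting ratio. -/
def limitRatio (q : ℝ) : ℝ :=
  √(1 / Real.pi) * √((2 : ℝ) ^ (2 / q) * Real.Gamma (1 / q) * Real.Gamma (2 - 1 / q))

/-- By the reflection formula the square of the ratio is 4^s (1 - s) / sin(πs), with s = 1/q. -/
lemma limitRatio_eq_exp {q : ℝ} (hq1 : 4 / 3 < q) (hq2 : q < 2) :
    limitRatio q = exp (-(logGap (1 / q) / 2)) := by
  have hq0 : 0 < q := by linarith
  have hs1 : 1 / 2 < 1 / q := by rw [lt_div_iff₀ hq0]; linarith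
  have hs2 : 1 / q < 3 / 4 := by rw [div_lt_iff₀ hq0]; linarith
  have hp : (2 : ℝ) ^ (2 / q) = 4 ^ (1 / q) := by
    rw [show (4 : ℝ) = 2 ^ (2 : ℝ) by norm_num, ← Real.rpow_mul zero_le_two]
    congr 1; ring
  rw [limitRatio, hp]
  generalize 1 / q = s at *
  have hv0 : 0 < 1 - s := by linarith
  have hsin : 0 < sin (π * s) := sin_pos_of_pos_of_lt_pi (mul_pos pi_pos (by linarith))
    (by nlinarith [pi_pos])
  have h1 := Gamma_mul_Gamma_one_sub s
  have h3 : Gamma (2 - s) = (1 - s) * Gamma (1 - s) := by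
    rw [show 2 - s = (1 - s) + 1 by ring, Gamma_add_one hv0.ne']
  have h4 : 1 / π * (4 ^ s * Gamma s * Gamma (2 - s)) = exp (-logGap s) := by
    have h5 : exp (-logGap s) = 4 ^ s * (1 - s) / sin (π * s) := by
      rw [logGap, show -(log (sin (π * s)) - log (1 - s) - s * log 4) =
        log 4 * s + log (1 - s) - log (sin (π * s)) by ring, exp_sub, exp_add, exp_log hv0,
        exp_log hsin, ← Real.rpow_def_of_pos (by norm_num)]
    rw [h5, h3, show 4 ^ s * Gamma s * ((1 - s) * Gamma (1 - s)) =
      4 ^ s * (1 - s) * (Gamma s * Gamma (1 - s)) by ring, h1]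
    field_simp
  rw [← Real.sqrt_mul (by positivity), h4, ← Real.exp_half]
  congr 1; ring

lemma logGap_pos {q : ℝ} (hq1 : 4 / 3 < q) (hq2 : q < 2) : 0 < logGap (1 / q) := by
  have hq0 : 0 < q := by linarith
  have hs1 : 1 / 2 < 1 / q := by rw [lt_div_iff₀ hq0]; linarith
  have hs2 : 1 / q < 3 / 4 := by rw [div_lt_iff₀ hq0]; linarith
  refine lt_of_lt_of_le ?_ (le_logGap hs1.le hs2.le)
  have h1 : 0 < 3 / 4 - 1 / q := by linarith
  have h2 : 0 < 1 / q - 1 / 2 := by linarith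
  positivity

/-- The threshold for the dimension in terms of `s = 1/q`. -/
lemma threshold_eq {q : ℝ} (hq1 : 4 / 3 < q) (hq2 : q < 2) :
    (32 / 15 : ℝ) / (q - 4 / 3) + (24 / 5 : ℝ) / (2 - q) =
      8 * (1 / q) * (5 - 4 * (1 / q)) / (5 * ((3 - 4 * (1 / q)) * (2 * (1 / q) - 1))) := by
  have hq0 : 0 < q := by linarith
  have h1 : q - 4 / 3 ≠ 0 := by linarith
  have h2 : 2 - q ≠ 0 := by linarith
  have h3 : 3 * q - 4 ≠ 0 := by intro h; apply h1; linarith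
  have e1 : q - 4 / 3 = (3 * q - 4) / 3 := by ring
  have e2 : 3 - 4 * (1 / q) = (3 * q - 4) / q := by field_simp
  have e3 : 2 * (1 / q) - 1 = (2 - q) / q := by field_simp
  have e4 : 5 - 4 * (1 / q) = (5 * q - 4) / q := by field_simp
  rw [e1, e2, e3, e4]
  field_simp
  ring

lemma gap_of_threshold_lt {q : ℝ} (hq1 : 4 / 3 < q) (hq2 : q < 2) {n : ℕ}
    (hn : (32 / 15 : ℝ) / (q - 4 / 3) + (24 / 5 : ℝ) / (2 - q) < (n : ℝ)) :
    21 ≤ n ∧ (6 / 25 : ℝ) / n < logGap (1 / q) / 2 := by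
  have hq0 : 0 < q := by linarith
  have hs1 : 1 / 2 < 1 / q := by rw [lt_div_iff₀ hq0]; linarith
  have hs2 : 1 / q < 3 / 4 := by rw [div_lt_iff₀ hq0]; linarith
  rw [threshold_eq hq1 hq2] at hn
  have hgap := le_logGap hs1.le hs2.le
  generalize 1 / q = s at *
  have hP : 0 < (3 - 4 * s) * (2 * s - 1) := mul_pos (by linarith) (by linarith)
  rw [div_lt_iff₀ (by positivity)] at hn
  -- A concave function of s, equal to 3/2 at both ends 1/2 and 3/4.
  have hq3 : 3 / 2 ≤ s * (5 - 4 * s) := by nlinarith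
  -- The difference of the sides is 12 (8s - 5)². It shows that the threshold is at least 20, so n ≥
  -- 21.
  have hsq : 100 * ((3 - 4 * s) * (2 * s - 1)) ≤ 8 * s * (5 - 4 * s) := by
    nlinarith [sq_nonneg (8 * s - 5)]
  have hn20 : (20 : ℝ) < n := by
    by_contra! h
    nlinarith
  refine ⟨by exact_mod_cast hn20, ?_⟩
  have hp := pi_gt_d4
  have hp2 : 9.8 ≤ π ^ 2 := by nlinarith
  rw [div_lt_iff₀ (by linarith)]
  have h1 : π ^ 2 / 6 * ((3 / 4 - s) * (s - 1 / 2)) =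
      π ^ 2 / 48 * ((3 - 4 * s) * (2 * s - 1)) := by ring
  rw [h1] at hgap
  have h2 : 9.8 / 48 * ((3 - 4 * s) * (2 * s - 1)) ≤ logGap s := by
    refine le_trans ?_ hgap
    gcongr
  have h3 : 9.8 / 48 * ((3 - 4 * s) * (2 * s - 1)) / 2 * n ≤ logGap s / 2 * n := by gcongr
  refine lt_of_lt_of_le ?_ h3
  -- The threshold and s(5 - 4s) ≥ 3/2 give more than (9.8/96) · (8/5) · (3/2) = 0.245, which
  -- exceeds 6/25.
  nlinarith

/-! ### Comparison of the two directions -/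

lemma absMoment_two_pos {q : ℝ} (hq : 1 < q) : 0 < absMoment q 2 := by
  have : 0 < Gamma (1 / q) := Gamma_pos_of_pos (by positivity)
  rw [absMoment_two hq]; positivity

lemma projVol_ratio {q : ℝ} (hq : 1 < q) {n : ℕ} (hn : 2 ≤ n) :
    projVol n q (diagVec n n) / projVol n q (diagVec n 2) =
      absMoment q n / √n * (√2 / absMoment q 2) := by
  have hΓ : 0 < Gamma (1 / q) := Gamma_pos_of_pos (by positivity)
  have hA := absMoment_two_pos hq
  have hn0 : (0 : ℝ) < √n := Real.sqrt_pos.2 (by exact_mod_cast (by omega : 0 < n))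
  rw [projVol_diagVec hq hn (by omega) le_rfl, projVol_diagVec hq hn (by omega) hn]
  push_cast
  field_simp

lemma limitRatio_eq {q : ℝ} (hq : 1 < q) :
    sdXi q * √(π / 2) * (√2 / absMoment q 2) = limitRatio q := by
  have h1 : 1 / q < 1 := by rw [div_lt_one (by linarith)]; exact hq
  have h2 : 0 < 1 / q := by positivity
  have hΓ : 0 < Gamma (1 / q) := Gamma_pos_of_pos h2
  have hΓ2 : 0 < Gamma (2 - 1 / q) := Gamma_pos_of_pos (by linarith)
  have hA := absMoment_two_pos hq
  have hσ := sdXi_pos hq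
  rw [limitRatio, ← Real.sqrt_mul (by positivity)]
  refine (Real.sqrt_eq_iff_mul_self_eq (by positivity) (by positivity)).2 ?_ |>.symm
  have e1 : sdXi q * √(π / 2) * (√2 / absMoment q 2) * (sdXi q * √(π / 2) * (√2 / absMoment q 2)) =
      sdXi q ^ 2 * (√(π / 2) ^ 2) * (√2 ^ 2) / absMoment q 2 ^ 2 := by ring
  rw [e1, sdXi_sq hq, Real.sq_sqrt (by positivity), Real.sq_sqrt zero_le_two, absMoment_two hq]
  have e2 : (2 : ℝ) ^ (2 / q) = (2 ^ (1 / q)) ^ 2 := by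
    rw [← Real.rpow_natCast, ← Real.rpow_mul zero_le_two]
    congr 1; push_cast; ring
  rw [e2, Real.rpow_sub two_pos, Real.rpow_one]
  field_simp

theorem theorem2 (q : ℝ) (hq₁ : 4 / 3 < q) (hq₂ : q < 2) :
    Tendsto (fun n : ℕ => projVol n q (diagVec n n) / projVol n q (diagVec n 2)) atTop
        (𝓝 (√(1 / Real.pi) *
          √((2 : ℝ) ^ (2 / q) * Real.Gamma (1 / q) * Real.Gamma (2 - 1 / q)))) ∧
      √(1 / Real.pi) *
          √((2 : ℝ) ^ (2 / q) * Real.Gamma (1 / q) * Real.Gamma (2 - 1 / q)) < 1 ∧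
      ∀ n : ℕ, (32 / 15 : ℝ) / (q - 4 / 3) + (24 / 5 : ℝ) / (2 - q) < (n : ℝ) →
        projVol n q (diagVec n n) < projVol n q (diagVec n 2) := by
  have hq : 1 < q := by linarith
  have hA := absMoment_two_pos hq
  have hgap := logGap_pos hq₁ hq₂
  have hR := limitRatio_eq_exp hq₁ hq₂
  refine ⟨?_, ?_, fun n hn => ?_⟩
  · change Tendsto _ atTop (𝓝 (limitRatio q))
    rw [← limitRatio_eq hq]
    refine ((tendsto_absMoment_div_sqrt hq).mul_const _).congr' ?_
    filter_upwards [eventually_ge_atTop 2] with n hn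
    rw [projVol_ratio hq hn]
  · change limitRatio q < 1
    rw [hR, exp_lt_one_iff]
    linarith
  · obtain ⟨hn21, hn'⟩ := gap_of_threshold_lt hq₁ hq₂ hn
    have hn0 : (0 : ℝ) < √n := Real.sqrt_pos.2 (by exact_mod_cast (by omega : 0 < n))
    have hpos : 0 < projVol n q (diagVec n 2) := by
      have hΓ : 0 < Gamma (1 / q) := Gamma_pos_of_pos (by positivity)
      rw [projVol_diagVec hq (by omega) (by omega) (by omega)]
      positivity
    rw [← div_lt_one hpos, projVol_ratio hq (by omega)]
    have hle := absMoment_le hq (fun u hu => abs_charNorm_le_div hq₁ hq₂ hu) hn21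
    have h1 : absMoment q n / √n ≤ sdXi q * √(π / 2) * (1 + (6 / 25) / n) := by
      rw [div_le_iff₀ hn0]
      linarith
    calc absMoment q n / √n * (√2 / absMoment q 2)
        ≤ sdXi q * √(π / 2) * (1 + (6 / 25) / n) * (√2 / absMoment q 2) := by gcongr
      _ = limitRatio q * (1 + (6 / 25) / n) := by rw [← limitRatio_eq hq]; ring
      _ < limitRatio q * (logGap (1 / q) / 2 + 1) := by
        have : 0 < limitRatio q := by rw [hR]; exact exp_pos _
        exact mul_lt_mul_of_pos_left (by linarith) this
      _ ≤ limitRatio q * exp (logGap (1 / q) / 2) := by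
        have : 0 < limitRatio q := by rw [hR]; exact exp_pos _
        gcongr
        exact add_one_le_exp _
      _ = 1 := by rw [hR, ← exp_add, neg_add_cancel, exp_zero]

end
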